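/- Let $k$ be an algebraically closed field of characteristic zero and let $H$ be a finite-dimensional semisimple Hopf algebra over $k$ with comultiplication $\Delta(h)=h_1\otimes h_2$ and antipode $S$. A Hopf subalgebra $A\subseteq H$ is called normal if $h_1AS(h_2)\subseteq A$ and $S(h_1)Ah_2\subseteq A$ for all $h\in H$. A Hopf algebra is called simple if it is different from $k$ and its only normal Hopf subalgebras are $k$ and itself. For a family $(K_i)_{i\in I}$ of Hopf subalgebras of $H$ let $\langle K_i\mid i\in I\rangle$ be the Hopf subalgebra generated by them. We say that $H$ is the internal tensor product of the family, written $H=\otimes_{i\in I}K_i$, if every $K_i$ is normal in $H$, $H=\langle K_i\mid i\in I\rangle$, and $K_i\cap\langle K_j\mid j\ne i\rangle=k$ for every $i\in I$. If moreover every $K_i$ is a simple semisimple Hopf algebra, this is called a Krull–Schmidt–Remak type decomposition of $H$. Corollary 4.6. Suppose that $H=\otimes_{i=1}^{r}K_i$ and $H=\otimes_{j=1}^{s}L_j$ are two Krull–Schmidt–Remak type decompositions of $H$. Then $r=s$, and there is a permutation $\sigma$ of $\{1,\dots,r\}$ such that $K_i\cong L_{\sigma(i)}$ as Hopf algebras for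 all $i\in\{1,\dots,r\}$. -/

import Mathlib

open scoped TensorProduct

/-- A Hopf subalgebra `A` of a Hopf algebra `H` over a field `k`: a unital subalgebra with
`Δ(A) ⊆ A ⊗ A` (the image of `A ⊗ A` in `H ⊗ H`) and `S(A) ⊆ A`. -/
structure HopfSubalgebra (k H : Type*) [Field k] [Ring H] [HopfAlgebra k H]
    extends Subalgebra k H where
  comul_mem' : ∀ x ∈ toSubalgebra,
    Bialgebra.comulAlgHom k H x ∈
      (Algebra.TensorProduct.map toSubalgebra.val toSubalgebra.val).range
  antipode_mem' : ∀ x ∈ toSubalgebra, HopfAlgebra.antipode k x ∈ toSubalgebra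

namespace HopfSubalgebra

section HopfStructure

variable {k H : Type*} [Field k] [Ring H] [HopfAlgebra k H] (A : HopfSubalgebra k H)

/-- The inclusion `A → H`. -/
noncomputable def incl : A.toSubalgebra →ₗ[k] H := A.toSubalgebra.val.toLinearMap

theorem incl_apply (x : A.toSubalgebra) : A.incl x = (x : H) := rfl

theorem incl_injective : Function.Injective A.incl := Subtype.val_injective

theorem map_incl_injective : Function.Injective (TensorProduct.map A.incl A.incl) :=
  TensorProduct.map_injective_of_flat_flat _ _ A.incl_injective A.incl_injective

theorem comul_mem_range (x : A.toSubalgebra) :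
    (Coalgebra.comul (R := k) ∘ₗ A.incl) x ∈
      LinearMap.range (TensorProduct.map A.incl A.incl) := by
  obtain ⟨y, hy⟩ := A.comul_mem' x.1 x.2
  exact ⟨y, hy⟩

/-- The comultiplication of `H` restricted to `A → A ⊗ A`. -/
noncomputable def comulRestrict :
    A.toSubalgebra →ₗ[k] A.toSubalgebra ⊗[k] A.toSubalgebra :=
  (LinearEquiv.ofInjective (TensorProduct.map A.incl A.incl) A.map_incl_injective).symm.toLinearMap
    ∘ₗ LinearMap.codRestrict _ (Coalgebra.comul (R := k) ∘ₗ A.incl) A.comul_mem_range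

theorem map_comulRestrict (x : A.toSubalgebra) :
    TensorProduct.map A.incl A.incl (A.comulRestrict x) = Coalgebra.comul (R := k) (x : H) := by
  have h := LinearEquiv.ofInjective_symm_apply (f := TensorProduct.map A.incl A.incl)
    (h := A.map_incl_injective) (LinearMap.codRestrict _ (Coalgebra.comul (R := k) ∘ₗ A.incl)
      A.comul_mem_range x)
  exact h

theorem map_comp_comulRestrict :
    TensorProduct.map A.incl A.incl ∘ₗ A.comulRestrict = Coalgebra.comul (R := k) ∘ₗ A.incl :=
  LinearMap.ext A.map_comulRestrict

noncomputable instance instCoalgebra : Coalgebra k A.toSubalgebra where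
  comul := A.comulRestrict
  counit := Coalgebra.counit (R := k) ∘ₗ A.incl
  coassoc := by
    have hinj : Function.Injective
        (TensorProduct.map A.incl (TensorProduct.map A.incl A.incl)) :=
      TensorProduct.map_injective_of_flat_flat _ _ A.incl_injective A.map_incl_injective
    apply LinearMap.ext
    intro x
    apply hinj
    have h1 : TensorProduct.map A.incl (TensorProduct.map A.incl A.incl) ∘ₗ
        (TensorProduct.assoc k _ _ _).toLinearMap ∘ₗ A.comulRestrict.rTensor _ =
        (TensorProduct.assoc k _ _ _).toLinearMap ∘ₗ
          (Coalgebra.comul (R := k)).rTensor H ∘ₗ TensorProduct.map A.incl A.incl := by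
      rw [LinearMap.rTensor_comp_map, ← A.map_comp_comulRestrict, ← LinearMap.comp_assoc,
        TensorProduct.map_map_comp_assoc_eq, LinearMap.comp_assoc, LinearMap.map_comp_rTensor]
    have h2 : TensorProduct.map A.incl (TensorProduct.map A.incl A.incl) ∘ₗ
        A.comulRestrict.lTensor _ =
          (Coalgebra.comul (R := k)).lTensor H ∘ₗ TensorProduct.map A.incl A.incl := by
      rw [LinearMap.lTensor_comp_map, ← A.map_comp_comulRestrict, LinearMap.map_comp_lTensor]
    have e1 := LinearMap.congr_fun h1 (A.comulRestrict x)
    have e2 := LinearMap.congr_fun h2 (A.comulRestrict x)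
    simp only [LinearMap.comp_apply, A.map_comulRestrict] at e1 e2 ⊢
    rw [e1, e2]
    exact Coalgebra.coassoc_apply (R := k) (x : H)
  rTensor_counit_comp_comul := by
    apply LinearMap.ext
    intro x
    have hinj : Function.Injective (A.incl.lTensor k) :=
      Module.Flat.lTensor_preserves_injective_linearMap _ A.incl_injective
    apply hinj
    have h1 : A.incl.lTensor k ∘ₗ (Coalgebra.counit (R := k) ∘ₗ A.incl).rTensor _ =
        (Coalgebra.counit (R := k)).rTensor H ∘ₗ TensorProduct.map A.incl A.incl := by
      rw [LinearMap.lTensor_comp_rTensor, LinearMap.rTensor_comp_map]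
    have e1 := LinearMap.congr_fun h1 (A.comulRestrict x)
    simp only [LinearMap.comp_apply, A.map_comulRestrict] at e1 ⊢
    rw [e1]
    simp [incl_apply]
  lTensor_counit_comp_comul := by
    apply LinearMap.ext
    intro x
    have hinj : Function.Injective (A.incl.rTensor k) :=
      Module.Flat.rTensor_preserves_injective_linearMap _ A.incl_injective
    apply hinj
    have h1 : A.incl.rTensor k ∘ₗ (Coalgebra.counit (R := k) ∘ₗ A.incl).lTensor _ =
        (Coalgebra.counit (R := k)).lTensor H ∘ₗ TensorProduct.map A.incl A.incl := by
      rw [LinearMap.rTensor_comp_lTensor, LinearMap.lTensor_comp_map]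
    have e1 := LinearMap.congr_fun h1 (A.comulRestrict x)
    simp only [LinearMap.comp_apply, A.map_comulRestrict] at e1 ⊢
    rw [e1]
    simp [incl_apply]

theorem map_comul (x : A.toSubalgebra) :
    TensorProduct.map A.incl A.incl (Coalgebra.comul (R := k) x) =
      Coalgebra.comul (R := k) (x : H) := A.map_comulRestrict x

theorem counit_coe (x : A.toSubalgebra) :
    Coalgebra.counit (R := k) x = Coalgebra.counit (R := k) (x : H) := rfl

theorem map_incl_mul (x y : A.toSubalgebra ⊗[k] A.toSubalgebra) :
    TensorProduct.map A.incl A.incl (x * y) =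
      TensorProduct.map A.incl A.incl x * TensorProduct.map A.incl A.incl y :=
  map_mul (Algebra.TensorProduct.map A.toSubalgebra.val A.toSubalgebra.val) x y

noncomputable instance instBialgebra : Bialgebra k A.toSubalgebra :=
  Bialgebra.mk' k A.toSubalgebra
    (by rw [counit_coe]; exact Bialgebra.counit_one)
    (by intro a b; simp only [counit_coe]; exact Bialgebra.counit_mul _ _)
    (by
      apply A.map_incl_injective
      rw [map_comul]
      exact Bialgebra.comul_one)
    (by
      intro a b
      apply A.map_incl_injective
      rw [map_incl_mul]
      simp only [map_comul]
      exact Bialgebra.comul_mul _ _)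

/-- The antipode of `H` restricted to `A → A`. -/
noncomputable def antipodeRestrict : A.toSubalgebra →ₗ[k] A.toSubalgebra :=
  LinearMap.codRestrict (Subalgebra.toSubmodule A.toSubalgebra)
    (HopfAlgebra.antipode k ∘ₗ A.incl) (fun x => A.antipode_mem' x.1 x.2)

theorem incl_comp_antipodeRestrict :
    A.incl ∘ₗ A.antipodeRestrict = HopfAlgebra.antipode k ∘ₗ A.incl := rfl

theorem incl_comp_mul' :
    A.incl ∘ₗ LinearMap.mul' k A.toSubalgebra =
      LinearMap.mul' k H ∘ₗ TensorProduct.map A.incl A.incl :=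
  TensorProduct.ext' fun _ _ => rfl

/-- A Hopf subalgebra is a Hopf algebra with the restricted structure maps. -/
noncomputable instance instHopfAlgebra : HopfAlgebra k A.toSubalgebra where
  antipode := A.antipodeRestrict
  mul_antipode_rTensor_comul := by
    apply LinearMap.ext
    intro x
    apply A.incl_injective
    have h1 : A.incl ∘ₗ LinearMap.mul' k A.toSubalgebra ∘ₗ A.antipodeRestrict.rTensor _ =
        LinearMap.mul' k H ∘ₗ (HopfAlgebra.antipode k).rTensor H ∘ₗ
          TensorProduct.map A.incl A.incl := by
      rw [← LinearMap.comp_assoc, incl_comp_mul', LinearMap.comp_assoc,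
        LinearMap.map_comp_rTensor, LinearMap.rTensor_comp_map, incl_comp_antipodeRestrict]
    have e1 := LinearMap.congr_fun h1 (Coalgebra.comul (R := k) x)
    simp only [LinearMap.comp_apply, map_comul] at e1 ⊢
    rw [e1]
    exact HopfAlgebra.mul_antipode_rTensor_comul_apply (R := k) (x : H)
  mul_antipode_lTensor_comul := by
    apply LinearMap.ext
    intro x
    apply A.incl_injective
    have h1 : A.incl ∘ₗ LinearMap.mul' k A.toSubalgebra ∘ₗ A.antipodeRestrict.lTensor _ =
        LinearMap.mul' k H ∘ₗ (HopfAlgebra.antipode k).lTensor H ∘ₗ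
          TensorProduct.map A.incl A.incl := by
      rw [← LinearMap.comp_assoc, incl_comp_mul', LinearMap.comp_assoc,
        LinearMap.map_comp_lTensor, LinearMap.lTensor_comp_map, incl_comp_antipodeRestrict]
    have e1 := LinearMap.congr_fun h1 (Coalgebra.comul (R := k) x)
    simp only [LinearMap.comp_apply, map_comul] at e1 ⊢
    rw [e1]
    exact HopfAlgebra.mul_antipode_lTensor_comul_apply (R := k) (x : H)

end HopfStructure

section Normal

variable {k H : Type*} [Field k] [Ring H] [HopfAlgebra k H]

/-- The left adjoint action `h₁ a S(h₂)`. -/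
noncomputable def leftAdjoint (k : Type*) {H : Type*} [Field k] [Ring H] [HopfAlgebra k H]
    (h a : H) : H :=
  LinearMap.mul' k H
    (TensorProduct.map (LinearMap.mulRight k a) (HopfAlgebra.antipode k)
      (Coalgebra.comul (R := k) h))

/-- The right adjoint action `S(h₁) a h₂`. -/
noncomputable def rightAdjoint (k : Type*) {H : Type*} [Field k] [Ring H] [HopfAlgebra k H]
    (h a : H) : H :=
  LinearMap.mul' k H
    (TensorProduct.map (HopfAlgebra.antipode k) (LinearMap.mulLeft k a)
      (Coalgebra.comul (R := k) h))

/-- `A` is normal in `H`: `h₁ A S(h₂) ⊆ A` and `S(h₁) A h₂ ⊆ A` for all `h ∈ H`. -/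
def IsNormal (A : HopfSubalgebra k H) : Prop :=
  ∀ h : H, ∀ a ∈ A.toSubalgebra,
    leftAdjoint k h a ∈ A.toSubalgebra ∧ rightAdjoint k h a ∈ A.toSubalgebra

end Normal

section Generate

variable {k H : Type*} [Field k] [Ring H] [HopfAlgebra k H]

/-- The Hopf subalgebra of `H` generated by a family of Hopf subalgebras; its underlying
algebra is the subalgebra generated by the family. -/
noncomputable def generate {ι : Type*} (K : ι → HopfSubalgebra k H) : HopfSubalgebra k H where
  toSubalgebra := ⨆ i, (K i).toSubalgebra
  comul_mem' := by
    intro x hx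
    have hle : (⨆ i, (K i).toSubalgebra) ≤
        (Algebra.TensorProduct.map (⨆ i, (K i).toSubalgebra).val
          (⨆ i, (K i).toSubalgebra).val).range.comap (Bialgebra.comulAlgHom k H) := by
      refine iSup_le fun i y hy => ?_
      obtain ⟨z, hz⟩ := (K i).comul_mem' y hy
      have hi : (K i).toSubalgebra ≤ ⨆ i, (K i).toSubalgebra :=
        le_iSup (fun i => (K i).toSubalgebra) i
      refine ⟨Algebra.TensorProduct.map (Subalgebra.inclusion hi) (Subalgebra.inclusion hi) z, ?_⟩
      refine Eq.trans ?_ hz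
      exact DFunLike.congr_fun (Algebra.TensorProduct.ext' (fun _ _ => rfl) :
        (Algebra.TensorProduct.map (⨆ i, (K i).toSubalgebra).val
          (⨆ i, (K i).toSubalgebra).val).comp
            (Algebra.TensorProduct.map (Subalgebra.inclusion hi) (Subalgebra.inclusion hi)) =
        Algebra.TensorProduct.map (K i).toSubalgebra.val (K i).toSubalgebra.val) z
    exact hle hx
  antipode_mem' := by
    intro x hx
    refine Algebra.iSup_induction (fun i => (K i).toSubalgebra)
      (motive := fun y => HopfAlgebra.antipode k y ∈ ⨆ i, (K i).toSubalgebra) hx ?_ ?_ ?_ ?_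
    · exact fun i y hy => le_iSup (fun i => (K i).toSubalgebra) i ((K i).antipode_mem' y hy)
    · intro y z hy hz
      rw [map_add]
      exact add_mem hy hz
    · intro y z hy hz
      rw [HopfAlgebra.antipode_mul_antidistrib]
      exact mul_mem hz hy
    · intro c
      rw [Algebra.algebraMap_eq_smul_one, map_smul, HopfAlgebra.antipode_one]
      exact Subalgebra.smul_mem _ (one_mem _) c

theorem generate_le {ι : Type*} (K : ι → HopfSubalgebra k H) (A : HopfSubalgebra k H)
    (h : ∀ i, (K i).toSubalgebra ≤ A.toSubalgebra) :
    (generate K).toSubalgebra ≤ A.toSubalgebra := iSup_le h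

/-- `H` is the internal tensor product of the family `K` of Hopf subalgebras: the `K i` are
normal in `H`, they generate `H`, and `K i ∩ ⟨K j | j ≠ i⟩ = k` for all `i`. -/
structure IsInternalTensorProduct {ι : Type*} (K : ι → HopfSubalgebra k H) : Prop where
  normal : ∀ i, (K i).IsNormal
  generate_eq_top : (generate K).toSubalgebra = ⊤
  inf_eq_bot : ∀ i,
    (K i).toSubalgebra ⊓ (generate fun j : {j : ι // j ≠ i} => K j).toSubalgebra = ⊥

end Generate

end HopfSubalgebra

/-- A Hopf algebra `H` over `k` is simple if `H ≠ k` and its only normal Hopf subalgebras are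
`k` and `H`. -/
def IsSimpleHopfAlgebra (k H : Type*) [Field k] [Ring H] [HopfAlgebra k H] : Prop :=
  (⊤ : Subalgebra k H) ≠ ⊥ ∧
    ∀ A : HopfSubalgebra k H, A.IsNormal → A.toSubalgebra = ⊥ ∨ A.toSubalgebra = ⊤

/-- A decomposition of Krull-Schmidt-Remak type: `H` is the internal tensor product of the
`K i`, and every `K i` is a simple semisimple Hopf algebra. -/
structure IsKrullSchmidtRemakDecomposition {k H : Type*} [Field k] [Ring H] [HopfAlgebra k H]
    {ι : Type*} (K : ι → HopfSubalgebra k H) : Prop where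
  internal : HopfSubalgebra.IsInternalTensorProduct K
  simple : ∀ i, IsSimpleHopfAlgebra k (K i).toSubalgebra
  semisimple : ∀ i, IsSemisimpleRing (K i).toSubalgebra

/-! The theorem follows from an exchange argument, as for finite direct products of simple groups.
Suppose `H = A ⊗ M` with `A` simple, and let `K` be a simple normal Hopf subalgebra not inside `M`.
Then `K ∩ M` is normal in `K`, hence trivial. The projection `p` of `H` onto `A` maps `K` to a
normal Hopf subalgebra of `A`, and this must be all of `A`, since otherwise `K` would lie in `M`. So
`p` restricts to an isomorphism from `K` to `A`, and `K` can replace `A` (`IsTensorPair.exchange`).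
Exchanging the `K i` one at a time against unused factors `L j` gives an injection of index sets
with isomorphic factors; by symmetry `r = s`, and the injection is a permutation.

Two facts make the internal tensor product behave like a genuine one. Normal Hopf subalgebras with
trivial intersection commute (`commute_of_isNormal`), by a Hopf version of the group commutator.
Next, the multiplication `A ⊗ M → H` is bijective, which is what provides the projections.
Surjectivity is clear from generation; injectivity comes from `BialgHom.injective_of_coinvariants`:
a surjection onto a finite-dimensional semisimple Hopf algebra is injective once its coinvariants
are scalars. That criterion rests on a functional `l` with `l(x₁) x₂ = l(x) 1` and an element `e`
with `l(x e) = ε(x)`. The same criterion shows that `p` is injective on `K`. -/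

open Coalgebra HopfAlgebra WithConv

/-! ### Contraction of a coalgebra by a functional -/

section LeftContract

theorem Coalgebra.Repr.sum_counit_right_smul {k C ι : Type*} [Field k] [AddCommGroup C]
    [Module k C] [Coalgebra k C] {c : C} (r : Coalgebra.Repr k c ι) :
    ∑ i ∈ r.index, counit (R := k) (r.right i) • r.left i = c := by
  have h := congrArg (_root_.TensorProduct.rid k C) (sum_tmul_counit_eq r)
  simpa only [map_sum, _root_.TensorProduct.rid_tmul, one_smul] using h

variable {k C D : Type*} [Field k] [AddCommGroup C] [Module k C] [Coalgebra k C]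
  [AddCommGroup D] [Module k D] [Coalgebra k D]

/-- The map `x ↦ φ(x₁) x₂` attached to a functional `φ` on a coalgebra. -/
noncomputable def Coalgebra.leftContract (φ : C →ₗ[k] k) : C →ₗ[k] C :=
  (TensorProduct.lid k C).toLinearMap ∘ₗ φ.rTensor C ∘ₗ comul

theorem Coalgebra.Repr.leftContract_apply {ι : Type*} {c : C} (r : Coalgebra.Repr k c ι)
    (φ : C →ₗ[k] k) :
    leftContract φ c = ∑ i ∈ r.index, φ (r.left i) • r.right i := by
  simp [leftContract, ← r.eq]

/-- By coassociativity both sides are `φ(c₁) c₂ ⊗ c₃`. -/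
theorem Coalgebra.comul_leftContract (φ : C →ₗ[k] k) (c : C) :
    comul (R := k) (leftContract φ c) = (leftContract φ).rTensor C (comul c) := by
  have h : (TensorProduct.lid k (C ⊗[k] C)).toLinearMap ∘ₗ φ.rTensor (C ⊗[k] C) ∘ₗ
      (_root_.TensorProduct.assoc k C C C).toLinearMap =
        ((TensorProduct.lid k C).toLinearMap ∘ₗ φ.rTensor C).rTensor C := by
    ext a b c
    simp [TensorProduct.smul_tmul']
  have h' : comul ∘ₗ (TensorProduct.lid k C).toLinearMap ∘ₗ φ.rTensor C =
      (TensorProduct.lid k (C ⊗[k] C)).toLinearMap ∘ₗ φ.rTensor (C ⊗[k] C) ∘ₗ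
        (comul (R := k)).lTensor C := by
    ext a b
    simp
  have e := LinearMap.congr_fun h' (comul (R := k) c)
  have e' := LinearMap.congr_fun h ((comul (R := k)).rTensor C (comul (R := k) c))
  simp only [LinearMap.comp_apply, LinearEquiv.coe_coe, coassoc_apply] at e e'
  simp only [leftContract, LinearMap.comp_apply]
  rw [e, e', ← LinearMap.rTensor_comp_apply]
  rfl

/-- The functional `ψ ∘ₗ leftContract φ` is the convolution product `c ↦ φ(c₁) ψ(c₂)`, so this
expresses that contraction is an action of the dual algebra. -/
theorem Coalgebra.leftContract_comp_leftContract (φ ψ : C →ₗ[k] k) (c : C) :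
    leftContract (ψ ∘ₗ leftContract φ) c = leftContract ψ (leftContract φ c) := by
  conv_rhs => rw [leftContract, LinearMap.comp_apply, LinearMap.comp_apply, comul_leftContract,
    ← LinearMap.rTensor_comp_apply]
  rfl

theorem Coalgebra.counit_leftContract (φ : C →ₗ[k] k) (c : C) :
    counit (R := k) (leftContract φ c) = φ c := by
  rw [(ℛ k c).leftContract_apply]
  conv_rhs => rw [← (ℛ k c).sum_counit_right_smul]
  simp [mul_comm]

theorem Coalgebra.map_leftContract (f : C →ₗc[k] D) (φ : D →ₗ[k] k) (c : C) :
    f (leftContract (φ ∘ₗ f.toLinearMap) c) = leftContract φ (f c) := by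
  rw [(ℛ k c).leftContract_apply, ((ℛ k c).induced f).leftContract_apply]
  simp

end LeftContract

/-! ### Integrals and cointegrals -/

section Integral

variable {k B : Type*} [Field k] [Ring B] [HopfAlgebra k B]

/-- A semisimple Hopf algebra has a normalized left integral. -/
theorem HopfAlgebra.exists_normalized_integral [IsSemisimpleRing B] :
    ∃ e : B, counit (R := k) e = 1 ∧ ∀ b : B, b * e = counit (R := k) b • e := by
  let I : Submodule B B := RingHom.ker (Bialgebra.counitAlgHom k B)
  have hI : ∀ x, x ∈ I ↔ counit (R := k) x = 0 := fun x => Iff.rfl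
  -- Semisimplicity splits off the augmentation ideal `I`; the integral is the `J`-component of `1`.
  -- The element `b e - ε(b) e` lies in both summands, hence vanishes.
  obtain ⟨J, hJ⟩ := exists_isCompl I
  have h1 : (1 : B) ∈ I ⊔ J := by rw [hJ.sup_eq_top]; trivial
  obtain ⟨u, hu, e, he, hue⟩ := Submodule.mem_sup.1 h1
  have hε : counit (R := k) e = 1 := by
    have := congrArg (counit (R := k)) hue
    rwa [map_add, (hI u).1 hu, zero_add, Bialgebra.counit_one] at this
  refine ⟨e, hε, fun b => ?_⟩
  have hJ' : b * e - counit (R := k) b • e ∈ J := by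
    refine J.sub_mem (J.smul_mem b he) ?_
    rw [Algebra.smul_def]
    exact J.smul_mem _ he
  have hI' : b * e - counit (R := k) b • e ∈ I := by
    rw [hI, map_sub, map_smul, Bialgebra.counit_mul, smul_eq_mul, sub_self]
  have := (Submodule.disjoint_def.1 hJ.disjoint) _ hI' hJ'
  exact sub_eq_zero.1 this

/-- Since `1 ⊗ a = (S(a₁) ⊗ 1) Δ(a₂)`, and `Δ(a₂) Δ(e) = Δ(a₂ e) = ε(a₂) Δ(e)`, the second tensor
factor can be moved to the first. -/
theorem HopfAlgebra.one_tmul_mul_comul_integral {e : B}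
    (he : ∀ b : B, b * e = counit (R := k) b • e) (a : B) :
    ((1 : B) ⊗ₜ[k] a) * comul (R := k) e = (antipode k a ⊗ₜ[k] (1 : B)) * comul (R := k) e := by
  let i₁ : WithConv (B →ₗ[k] B ⊗[k] B) :=
    toConv (Algebra.TensorProduct.includeLeft (R := k) (S := k) (A := B) (B := B)).toLinearMap
  let i₂ : WithConv (B →ₗ[k] B ⊗[k] B) :=
    toConv (Algebra.TensorProduct.includeRight (R := k) (A := B) (B := B)).toLinearMap
  let s : WithConv (B →ₗ[k] B ⊗[k] B) := toConv
    ((Algebra.TensorProduct.includeLeft (R := k) (S := k) (A := B) (B := B)).toLinearMap ∘ₗ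
      antipode k)
  have h1 : i₁ * i₂ = toConv comul := by
    ext x
    rw [(ℛ k x).convMul_apply]
    simp [i₁, i₂, (ℛ k x).eq]
  have h2 : s * i₁ = 1 := by
    ext x
    rw [(ℛ k x).convMul_apply]
    simp [i₁, s, ← TensorProduct.sum_tmul, sum_antipode_mul_eq_algebraMap_counit]
  have h3 : i₂ = s * toConv comul := by rw [← h1, ← mul_assoc, h2, one_mul]
  have h4 := congrArg (fun F : WithConv (B →ₗ[k] B ⊗[k] B) => F a) h3
  simp only [(ℛ k a).convMul_apply] at h4
  change (1 : B) ⊗ₜ[k] a = ∑ i ∈ _, (antipode k _ ⊗ₜ[k] (1 : B)) * comul (R := k) _ at h4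
  rw [h4, Finset.sum_mul]
  simp only [mul_assoc, ← Bialgebra.comul_mul, he, map_smul]
  conv_rhs => rw [← (ℛ k a).sum_counit_right_smul]
  simp only [map_sum, map_smul, TensorProduct.sum_tmul, Finset.sum_mul,
    ← TensorProduct.smul_tmul', smul_mul_assoc, mul_smul_comm]

/-- A finite-dimensional semisimple Hopf algebra has a functional `λ` with `λ(x₁) x₂ = λ(x) 1`
and an element `e` with `λ(x e) = ε(x)`. -/
theorem HopfAlgebra.exists_cointegral [IsSemisimpleRing B] [Module.Finite k B] :
    ∃ (l : B →ₗ[k] k) (e : B), (∀ x, leftContract l x = algebraMap k B (l x)) ∧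
      ∀ x, l (x * e) = counit (R := k) x := by
  obtain ⟨e, hε, he⟩ := HopfAlgebra.exists_normalized_integral (k := k) (B := B)
  let Θ : (B →ₗ[k] k) →ₗ[k] B :=
    { toFun := fun φ => leftContract φ e
      map_add' := fun φ ψ => by
        simp [(ℛ k e).leftContract_apply, add_smul, Finset.sum_add_distrib]
      map_smul' := fun c φ => by
        simp [(ℛ k e).leftContract_apply, mul_smul, Finset.smul_sum] }
  have hΘ : ∀ φ, Θ φ = leftContract φ e := fun _ => rfl
  -- The range of `Θ` is therefore a left ideal, so surjectivity reduces to reaching `1`.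
  have hideal : ∀ (a : B) φ, a * Θ φ = Θ (φ ∘ₗ LinearMap.mulLeft k (antipode k a)) := by
    intro a φ
    have h := congrArg (fun z => TensorProduct.lid k B (φ.rTensor B z))
      (one_tmul_mul_comul_integral he a)
    simp only [← (ℛ k e).eq, Finset.mul_sum, map_sum, Algebra.TensorProduct.tmul_mul_tmul,
      LinearMap.rTensor_tmul, TensorProduct.lid_tmul, one_mul] at h
    rw [hΘ, hΘ, (ℛ k e).leftContract_apply, (ℛ k e).leftContract_apply, Finset.mul_sum]
    simpa using h
  have hone : (1 : B) ∈ LinearMap.range Θ := by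
    let b := Module.finBasis k B
    -- With `Δ(e) = ∑ bᵢ ⊗ cᵢ`, each `cᵢ` is a contraction of `e` and `∑ S(bᵢ) cᵢ = ε(e) 1 = 1`.
    obtain ⟨c, hc⟩ := TensorProduct.eq_repr_basis_left b (comul (R := k) e)
    have hcm : ∀ i, c i ∈ LinearMap.range Θ := by
      intro i
      refine ⟨b.coord i, ?_⟩
      rw [hΘ, leftContract, LinearMap.comp_apply, LinearMap.comp_apply, ← hc]
      simp [Finsupp.sum, Finsupp.single_apply]
    have h1 : ∑ i ∈ c.support, antipode k (b i) * c i = 1 := by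
      have h := mul_antipode_rTensor_comul_apply (R := k) e
      rw [← hc, hε, map_one] at h
      simpa [Finsupp.sum] using h
    rw [← h1]
    refine Submodule.sum_mem _ fun i _ => ?_
    obtain ⟨φ, hφ⟩ := hcm i
    rw [← hφ, hideal]
    exact ⟨_, rfl⟩
  have hsurj : Function.Surjective Θ := by
    intro a
    obtain ⟨φ, hφ⟩ := hone
    exact ⟨_, by rw [← hideal a φ, hφ, mul_one]⟩
  have hinj : Function.Injective Θ :=
    (LinearMap.injective_iff_surjective_of_finrank_eq_finrank Subspace.dual_finrank_eq).2 hsurj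
  obtain ⟨l, hl⟩ := hsurj 1
  refine ⟨l, e, fun x => ?_, fun x => ?_⟩
  · refine sub_eq_zero.1 ((Module.forall_dual_apply_eq_zero_iff k _).1 fun ψ => ?_)
    -- Both functionals have image `ψ(1) 1` under the injective map `Θ`, because contracting `e` by
    -- `l` gives `1`.
    have h : ψ ∘ₗ leftContract l = ψ 1 • l := by
      apply hinj
      rw [map_smul, hl, hΘ, leftContract_comp_leftContract, ← hΘ, hl]
      simp [leftContract, Algebra.TensorProduct.one_def]
    have h' := LinearMap.congr_fun h x
    simp only [LinearMap.comp_apply, LinearMap.smul_apply, smul_eq_mul] at h'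
    rw [map_sub, h', Algebra.algebraMap_eq_smul_one, map_smul, smul_eq_mul, mul_comm, sub_self]
  · rw [he, map_smul, ← counit_leftContract l e, ← hΘ, hl, Bialgebra.counit_one, smul_eq_mul,
      mul_one]

end Integral

/-! ### Injectivity from trivial coinvariants -/

section Injective

variable {k A B : Type*} [Field k] [Ring A] [HopfAlgebra k A] [Ring B] [HopfAlgebra k B]

/-- A surjective bialgebra homomorphism onto a finite-dimensional semisimple Hopf algebra with
only trivial coinvariants is injective. -/
theorem BialgHom.injective_of_coinvariants [IsSemisimpleRing B] [Module.Finite k B]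
    (f : A →ₐc[k] B) (hf : Function.Surjective f)
    (hco : ∀ x : A, (f : A →ₗ[k] B).rTensor A (comul x) = 1 ⊗ₜ[k] x →
      x ∈ (⊥ : Subalgebra k A)) :
    Function.Injective f := by
  obtain ⟨l, e, hl, he⟩ := HopfAlgebra.exists_cointegral (k := k) (B := B)
  let E : A →ₗ[k] A := leftContract (l ∘ₗ (f : A →ₗ[k] B))
  have hE : ∀ y, E y = algebraMap k A (l (f y)) := by
    intro y
    -- Here `E y = l(f(y₁)) y₂` is coinvariant because `f(E z) = l(f z) 1`; being a scalar, it is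
    -- determined by its counit.
    have hmem : E y ∈ (⊥ : Subalgebra k A) := by
      apply hco
      rw [comul_leftContract, ← LinearMap.rTensor_comp_apply]
      have h1 : (f : A →ₗ[k] B) ∘ₗ leftContract (l ∘ₗ (f : A →ₗ[k] B)) =
          Algebra.linearMap k B ∘ₗ l ∘ₗ (f : A →ₗ[k] B) := by
        ext z
        exact (map_leftContract (f : A →ₗc[k] B) l z).trans (hl _)
      rw [h1, (ℛ k y).leftContract_apply, ← (ℛ k y).eq]
      simp [Algebra.algebraMap_eq_smul_one, TensorProduct.tmul_sum, TensorProduct.smul_tmul]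
    obtain ⟨c, hc⟩ := Algebra.mem_bot.1 hmem
    have h := counit_leftContract (l ∘ₗ (f : A →ₗ[k] B)) y
    change counit (R := k) (E y) = l (f y) at h
    rw [← hc, Bialgebra.counit_algebraMap] at h
    rw [← hc, h]
  rw [injective_iff_map_eq_zero]
  intro x hx
  obtain ⟨a, ha⟩ := hf e
  -- For `x` in the kernel take `G(y) = l(f(x₁ y)) x₂`. Then `(G * id)(y) = E(x y) = l(f(x) f(y)) =
  -- 0`, and convolving with the antipode gives `G = 0`. At a preimage of `e`, however, `G` takes
  -- the value `ε(x₁) x₂ = x`.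
  let G : WithConv (A →ₗ[k] A) := toConv (∑ i ∈ (ℛ k x).index,
    LinearMap.toSpanSingleton k A ((ℛ k x).right i) ∘ₗ l ∘ₗ (f : A →ₗ[k] B) ∘ₗ
      LinearMap.mulLeft k ((ℛ k x).left i))
  have hG : ∀ y, G y = ∑ i ∈ (ℛ k x).index,
      l (f ((ℛ k x).left i * y)) • (ℛ k x).right i := by
    intro y
    simp [G]
  have hG0 : G * toConv LinearMap.id = 0 := by
    ext y
    rw [(ℛ k y).convMul_apply]
    have h := hE (x * y)
    rw [((ℛ k x).mul (ℛ k y)).leftContract_apply, map_mul, hx, zero_mul, map_zero, map_zero] at h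
    refine Eq.trans ?_ h
    simp only [hG, Finset.sum_mul]
    rw [Finset.sum_comm, ← Finset.sum_product']
    simp [Coalgebra.Repr.mul]
  have hG1 : G = 0 := by
    rw [← mul_one G, ← LinearMap.id_mul_antipode, ← mul_assoc, hG0, zero_mul]
  have h := hG a
  rw [hG1] at h
  simp only [map_mul, ha, he] at h
  rw [← sum_counit_smul (ℛ k x)]
  simpa using h.symm

/-- The two composites are a left and a right convolution inverse of `f`, hence equal. -/
theorem BialgHom.map_antipode (f : A →ₐc[k] B) (x : A) :
    f (antipode k x) = antipode k (f x) := by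
  have h1 : toConv ((f : A →ₗ[k] B) ∘ₗ antipode k) * toConv (f : A →ₗ[k] B) = 1 := by
    ext y
    rw [(ℛ k y).convMul_apply]
    simp only [LinearMap.comp_apply, BialgHom.coe_toLinearMap, ← map_mul,
      ← map_sum, sum_antipode_mul_eq_algebraMap_counit]
    exact AlgHomClass.commutes f _
  have h2 : toConv (f : A →ₗ[k] B) * toConv (antipode k ∘ₗ (f : A →ₗ[k] B)) = 1 := by
    ext y
    rw [(ℛ k y).convMul_apply]
    simpa using sum_mul_antipode_eq_algebraMap_counit ((ℛ k y).induced f)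
  exact congrArg (fun F : WithConv (A →ₗ[k] B) => F x) (left_inv_eq_right_inv h1 h2)

end Injective

/-! ### Commutation of normal Hopf subalgebras -/

namespace HopfSubalgebra

variable {k H : Type*} [Field k] [Ring H] [HopfAlgebra k H]

/-- The inclusion of a Hopf subalgebra as a bialgebra homomorphism. -/
noncomputable def inclBialgHom (A : HopfSubalgebra k H) : A.toSubalgebra →ₐc[k] H :=
  BialgHom.ofAlgHom A.toSubalgebra.val (by ext; rfl) (AlgHom.ext A.map_comul)

@[simp]
theorem inclBialgHom_apply (A : HopfSubalgebra k H) (x : A.toSubalgebra) :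
    A.inclBialgHom x = x := rfl

theorem exists_repr (A : HopfSubalgebra k H) {x : H} (hx : x ∈ A.toSubalgebra) :
    ∃ r : Coalgebra.Repr k x (A.toSubalgebra × A.toSubalgebra),
      (∀ i, r.left i ∈ A.toSubalgebra) ∧ ∀ i, r.right i ∈ A.toSubalgebra :=
  ⟨(ℛ k (⟨x, hx⟩ : A.toSubalgebra)).induced A.inclBialgHom, fun _ => Subtype.property _,
    fun _ => Subtype.property _⟩

theorem leftAdjoint_eq_sum {ι : Type*} {h : H} (r : Coalgebra.Repr k h ι) (a : H) :
    leftAdjoint k h a = ∑ i ∈ r.index, r.left i * a * antipode k (r.right i) := by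
  simp [leftAdjoint, ← r.eq]

theorem rightAdjoint_eq_sum {ι : Type*} {h : H} (r : Coalgebra.Repr k h ι) (a : H) :
    rightAdjoint k h a = ∑ i ∈ r.index, antipode k (r.left i) * (a * r.right i) := by
  simp [rightAdjoint, ← r.eq]

theorem antipode_incl_mul_incl (A : HopfSubalgebra k H) :
    toConv (antipode k ∘ₗ A.incl) * toConv A.incl = 1 := by
  ext x
  rw [(ℛ k x).convMul_apply]
  exact sum_antipode_mul_eq_algebraMap_counit ((ℛ k x).induced A.inclBialgHom)

/-- The Hopf commutator `a₁ b₁ S(a₂) S(b₂)`, bracketed in two ways: one places it in the first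
subalgebra, the other in the second. -/
theorem sum_leftAdjoint_mul_antipode {ι κ : Type*} {a b : H} (r : Coalgebra.Repr k a ι)
    (t : Coalgebra.Repr k b κ) :
    ∑ j ∈ t.index, leftAdjoint k a (t.left j) * antipode k (t.right j) =
      ∑ i ∈ r.index, r.left i * leftAdjoint k b (antipode k (r.right i)) := by
  simp only [leftAdjoint_eq_sum r, leftAdjoint_eq_sum t, Finset.sum_mul, Finset.mul_sum, mul_assoc]
  exact Finset.sum_comm

theorem counit_leftAdjoint (a b : H) :
    counit (R := k) (leftAdjoint k a b) = counit (R := k) a * counit (R := k) b := by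
  rw [leftAdjoint_eq_sum (ℛ k a)]
  conv_rhs => rw [← sum_counit_smul (ℛ k a)]
  simp [Finset.sum_mul, mul_right_comm]

/-- By normality the commutator lies in `A ∩ B = k`, so it equals its counit `ε(a) ε(b)`. Convolving
with the inclusion of `B` cancels `S(b₂)`. -/
theorem leftAdjoint_eq_counit_smul {A B : HopfSubalgebra k H} (hA : A.IsNormal) (hB : B.IsNormal)
    (h : A.toSubalgebra ⊓ B.toSubalgebra = ⊥) {a b : H} (ha : a ∈ A.toSubalgebra)
    (hb : b ∈ B.toSubalgebra) : leftAdjoint k a b = counit (R := k) a • b := by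
  obtain ⟨r, hr₁, hr₂⟩ := A.exists_repr ha
  let F : WithConv (B.toSubalgebra →ₗ[k] H) := toConv
    ((∑ i ∈ r.index, LinearMap.mulRight k (antipode k (r.right i)) ∘ₗ
      LinearMap.mulLeft k (r.left i)) ∘ₗ B.incl)
  have hF : ∀ y, F y = leftAdjoint k a y := fun y => by
    simp [F, leftAdjoint_eq_sum r, incl_apply]
  have h1 : F * toConv (antipode k ∘ₗ B.incl) = counit (R := k) a • 1 := by
    ext y
    rw [(ℛ k y).convMul_apply]
    simp only [hF]
    let t := (ℛ k y).induced B.inclBialgHom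
    change ∑ j ∈ t.index, leftAdjoint k a (t.left j) * antipode k (t.right j) =
      counit (R := k) a • algebraMap k H (counit (R := k) y)
    have hmem : ∑ j ∈ t.index, leftAdjoint k a (t.left j) * antipode k (t.right j) ∈
        A.toSubalgebra ⊓ B.toSubalgebra := by
      constructor
      · rw [sum_leftAdjoint_mul_antipode r t]
        exact sum_mem fun i _ => mul_mem (hr₁ i) (hA _ _ (A.antipode_mem' _ (hr₂ i))).1
      · exact sum_mem fun j _ => mul_mem (hB _ _ (Subtype.property _)).1
          (B.antipode_mem' _ (Subtype.property _))
    rw [h] at hmem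
    obtain ⟨c, hc⟩ := Algebra.mem_bot.1 hmem
    have hε := congrArg (counit (R := k)) hc
    have hy := congrArg (counit (R := k)) (sum_counit_smul t)
    simp only [map_sum, map_smul, smul_eq_mul] at hy
    simp only [Bialgebra.counit_algebraMap, map_sum, Bialgebra.counit_mul, counit_leftAdjoint,
      counit_antipode, mul_assoc, ← Finset.mul_sum, hy] at hε
    rw [← hc, hε, map_mul, Algebra.smul_def]
    rfl
  have h2 : F = counit (R := k) a • toConv B.incl := by
    rw [← mul_one F, ← B.antipode_incl_mul_incl, ← mul_assoc, h1, smul_mul_assoc, one_mul]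
  rw [← hF ⟨b, hb⟩, h2]
  rfl

/-- Normal Hopf subalgebras with trivial intersection commute elementwise. -/
theorem commute_of_isNormal {A B : HopfSubalgebra k H} (hA : A.IsNormal) (hB : B.IsNormal)
    (h : A.toSubalgebra ⊓ B.toSubalgebra = ⊥) {a b : H} (ha : a ∈ A.toSubalgebra)
    (hb : b ∈ B.toSubalgebra) : Commute a b := by
  let G : WithConv (A.toSubalgebra →ₗ[k] H) := toConv (LinearMap.mulRight k b ∘ₗ A.incl)
  let E : WithConv (A.toSubalgebra →ₗ[k] H) := toConv (LinearMap.toSpanSingleton k H b ∘ₗ counit)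
  -- The computation is `a b = a₁ b S(a₂) a₃ = ε(a₁) b a₂ = b a`.
  have h1 : G * toConv (antipode k ∘ₗ A.incl) = E := by
    ext y
    rw [(ℛ k y).convMul_apply]
    exact (leftAdjoint_eq_sum ((ℛ k y).induced A.inclBialgHom) b).symm.trans
      (leftAdjoint_eq_counit_smul hA hB h y.2 hb)
  have h2 : G = E * toConv A.incl := by
    rw [← h1, mul_assoc, A.antipode_incl_mul_incl, mul_one]
  have h3 := congrArg (fun F : WithConv (A.toSubalgebra →ₗ[k] H) => F ⟨a, ha⟩) h2
  simp only [(ℛ k (⟨a, ha⟩ : A.toSubalgebra)).convMul_apply] at h3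
  refine Eq.trans h3 ?_
  have h4 := congrArg A.incl (sum_counit_smul (ℛ k (⟨a, ha⟩ : A.toSubalgebra)))
  change _ = a at h4
  conv_rhs => rw [← h4]
  simp [E, Finset.mul_sum]

end HopfSubalgebra

/-! ### Coinvariants of the multiplication map on a tensor product -/

namespace BialgHom

variable {k A B H : Type*} [Field k] [Ring A] [HopfAlgebra k A] [Ring B] [HopfAlgebra k B]
  [Ring H] [HopfAlgebra k H]

/-- The homomorphism `A ⊗ B → H`, `a ⊗ b ↦ f a * g b`, for `f` and `g` with commuting values. -/
noncomputable def tensorLift (f : A →ₐc[k] H) (g : B →ₐc[k] H)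
    (hfg : ∀ a b, Commute (f a) (g b)) : A ⊗[k] B →ₐc[k] H where
  toCoalgHom := (Bialgebra.mulCoalgHom k H).comp
    (Coalgebra.TensorProduct.map (f : A →ₗc[k] H) (g : B →ₗc[k] H))
  map_one' := by
    simp [Algebra.TensorProduct.one_def]
  map_mul' x y := by
    have h : ∀ z, LinearMap.mul' k H (TensorProduct.map (f : A →ₗ[k] H) (g : B →ₗ[k] H) z) =
        Algebra.TensorProduct.lift (f : A →ₐ[k] H) (g : B →ₐ[k] H) hfg z := by
      intro z
      induction z with
      | zero => simp
      | tmul a b => exact (Algebra.TensorProduct.lift_tmul (f : A →ₐ[k] H) (g : B →ₐ[k] H) hfg a b).symm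
      | add z w hz hw => simp only [map_add, hz, hw]
    have h' := map_mul (Algebra.TensorProduct.lift (f : A →ₐ[k] H) (g : B →ₐ[k] H) hfg) x y
    rw [← h, ← h, ← h] at h'
    exact h'

variable (f : A →ₐc[k] H) (g : B →ₐc[k] H) (hfg : ∀ a b, Commute (f a) (g b))

@[simp]
theorem tensorLift_tmul (a : A) (b : B) : tensorLift f g hfg (a ⊗ₜ b) = f a * g b := rfl

theorem mul_antipode_comp :
    toConv (g : B →ₗ[k] H) * toConv (antipode k ∘ₗ (g : B →ₗ[k] H)) = 1 := by
  ext x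
  rw [(ℛ k x).convMul_apply]
  simpa using sum_mul_antipode_eq_algebraMap_counit ((ℛ k x).induced g)

theorem map_eq_counit_of_coinvariant (x : A)
    (hx : (f : A →ₗ[k] H).rTensor A (comul x) = 1 ⊗ₜ[k] x) :
    f x = algebraMap k H (counit (R := k) x) := by
  have e := congrArg (fun w => TensorProduct.rid k H ((counit (R := k)).lTensor H w)) hx
  simp only [← (ℛ k x).eq, map_sum, LinearMap.rTensor_tmul, LinearMap.lTensor_tmul,
    TensorProduct.rid_tmul, ← map_smul] at e
  rw [← map_sum, (ℛ k x).sum_counit_right_smul] at e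
  rw [Algebra.algebraMap_eq_smul_one]
  exact e

/-- The element `c` is `(ε ⊗ id)(z)`. Applying `f g ⊗ (ε ⊗ id)` to `Δ(a ⊗ b)` leaves `f(a) g(b₁) ⊗
b₂`, and `Ψ` cancels `g(b₁)` by inserting `S(g(b₂)) ⊗ b₃`, which recovers `f(a) ⊗ b`. On a
coinvariant `z` the same procedure starts from `1 ⊗ z` and yields `S(g(c₁)) ⊗ c₂`. -/
theorem exists_of_tensorLift_coinvariant (z : A ⊗[k] B)
    (hz : (tensorLift f g hfg : A ⊗[k] B →ₗ[k] H).rTensor _ (comul z) = 1 ⊗ₜ[k] z) :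
    ∃ c : B, (f : A →ₗ[k] H).rTensor B z =
      ∑ j ∈ (ℛ k c).index, antipode k (g ((ℛ k c).left j)) ⊗ₜ[k] (ℛ k c).right j := by
  let i₁ : H →ₐ[k] H ⊗[k] B := Algebra.TensorProduct.includeLeft
  let i₂ : B →ₐ[k] H ⊗[k] B := Algebra.TensorProduct.includeRight
  let u : WithConv (B →ₗ[k] H ⊗[k] B) := toConv (i₁.toLinearMap ∘ₗ (g : B →ₗ[k] H))
  let s : WithConv (B →ₗ[k] H ⊗[k] B) :=
    toConv (i₁.toLinearMap ∘ₗ antipode k ∘ₗ (g : B →ₗ[k] H))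
  let v := s * toConv i₂.toLinearMap
  have hus : u * s = 1 := by
    have e := LinearMap.algHom_comp_convMul_distrib i₁ (toConv (g : B →ₗ[k] H))
      (toConv (antipode k ∘ₗ (g : B →ₗ[k] H)))
    rw [g.mul_antipode_comp] at e
    refine (congrArg toConv e).symm.trans ?_
    ext x
    simp
  have huv : u * v = toConv i₂.toLinearMap := by
    change u * (s * _) = _
    rw [← mul_assoc, hus, one_mul]
  let pB : A ⊗[k] B →ₗ[k] B :=
    (TensorProduct.lid k _).toLinearMap ∘ₗ (counit (R := k)).rTensor B
  let Ψ : H ⊗[k] B →ₗ[k] H ⊗[k] B :=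
    LinearMap.mul' k _ ∘ₗ TensorProduct.map i₁.toLinearMap v.ofConv
  have hΨ : Ψ ∘ₗ pB.lTensor H ∘ₗ (tensorLift f g hfg : A ⊗[k] B →ₗ[k] H).rTensor _ ∘ₗ comul =
      (f : A →ₗ[k] H).rTensor B := by
    ext a b
    have e := congrArg (fun F : WithConv (B →ₗ[k] H ⊗[k] B) => F b) huv
    simp only [(ℛ k b).convMul_apply] at e
    have e' := congrArg f (ℛ k a).sum_counit_right_smul
    have e'' : f a ⊗ₜ[k] b = i₁ (f a) * i₂ b := by simp [i₁, i₂]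
    have lhs : (Ψ ∘ₗ pB.lTensor H ∘ₗ (tensorLift f g hfg : A ⊗[k] B →ₗ[k] H).rTensor _ ∘ₗ comul)
        (a ⊗ₜ b) = ∑ i ∈ (ℛ k a).index, ∑ j ∈ (ℛ k b).index,
          i₁ (f ((ℛ k a).left i) * g ((ℛ k b).left j)) *
            (counit (R := k) ((ℛ k a).right i) • v.ofConv ((ℛ k b).right j)) := by
      simp only [LinearMap.comp_apply, ← ((ℛ k a).tmul (ℛ k b)).eq, map_sum]
      rw [← Finset.sum_product']
      refine Finset.sum_congr rfl fun p _ => ?_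
      simp [Ψ, pB, Coalgebra.Repr.tmul]
    refine lhs.trans (Eq.trans ?_ e''.symm)
    conv_rhs => rw [← e']
    have e3 : ∑ j ∈ (ℛ k b).index, i₁ (g ((ℛ k b).left j)) * v.ofConv ((ℛ k b).right j) = i₂ b := e
    rw [← e3]
    simp only [map_mul, map_sum, map_smul, Finset.sum_mul, Finset.mul_sum, mul_assoc,
      mul_smul_comm, smul_mul_assoc]
    exact Finset.sum_comm
  refine ⟨pB z, ?_⟩
  have hz' : (f : A →ₗ[k] H).rTensor B z = v (pB z) := by
    rw [← hΨ]
    simp only [LinearMap.comp_apply, hz]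
    simp [Ψ]
  rw [hz']
  change (s * toConv i₂.toLinearMap) (pB z) = _
  rw [(ℛ k (pB z)).convMul_apply]
  simp [s, i₁, i₂]

/-- If `f` and `g` are injective with commuting values and images meeting only in the scalars,
then `a ⊗ b ↦ f a * g b` has only trivial coinvariants. -/
theorem tensorLift_coinvariant (hf : Function.Injective f) (hg : Function.Injective g)
    (hinf : ∀ a, f a ∈ (g : B →ₐ[k] H).range → f a ∈ (⊥ : Subalgebra k H)) (z : A ⊗[k] B)
    (hz : (tensorLift f g hfg : A ⊗[k] B →ₗ[k] H).rTensor _ (comul z) = 1 ⊗ₜ[k] z) :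
    z ∈ (⊥ : Subalgebra k (A ⊗[k] B)) := by
  obtain ⟨c, hc⟩ := exists_of_tensorLift_coinvariant f g hfg z hz
  let b := Module.Basis.ofVectorSpace k B
  obtain ⟨a, ha⟩ := TensorProduct.eq_repr_basis_right b z
  -- Comparing coefficients of basis vectors of `B` puts each `f(aᵢ)` in the image of `g`, so each
  -- `aᵢ` is a scalar and `z = 1 ⊗ y`.
  have hcoef : ∀ i, ∃ t : k, a i = t • 1 := by
    classical
    intro i
    have e := congrArg (fun w => TensorProduct.rid k H ((b.coord i).lTensor H w)) hc
    simp only [← ha] at e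
    have e' : f (a i) = ∑ j ∈ (ℛ k c).index,
        b.coord i ((ℛ k c).right j) • antipode k (g ((ℛ k c).left j)) := by
      have hi : (if a i = 0 then 0 else f (a i)) = f (a i) := by
        split_ifs with h
        · rw [h, map_zero]
        · rfl
      rw [← hi]
      simpa [Finsupp.sum, Finsupp.single_apply] using e
    have hmem : f (a i) ∈ (g : B →ₐ[k] H).range := by
      rw [e']
      refine sum_mem fun j _ => Subalgebra.smul_mem _ ?_ _
      rw [← map_antipode]
      exact ⟨_, rfl⟩
    obtain ⟨t, ht⟩ := Algebra.mem_bot.1 (hinf _ hmem)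
    refine ⟨t, hf ?_⟩
    rw [← ht, map_smul, map_one, Algebra.algebraMap_eq_smul_one]
  choose t ht using hcoef
  have hz1 : z = 1 ⊗ₜ (∑ i ∈ a.support, t i • b i) := by
    rw [← ha, Finsupp.sum, TensorProduct.tmul_sum]
    refine Finset.sum_congr rfl fun i _ => ?_
    rw [ht i, TensorProduct.smul_tmul]
  have hfz := map_eq_counit_of_coinvariant _ z hz
  have hy : ∑ i ∈ a.support, t i • b i = counit (R := k) z • 1 := by
    apply hg
    rw [map_smul, map_one, ← Algebra.algebraMap_eq_smul_one, ← hfz]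
    conv_rhs => rw [hz1]
    rw [tensorLift_tmul, map_one, one_mul]
  refine Algebra.mem_bot.2 ⟨counit (R := k) z, ?_⟩
  conv_rhs => rw [hz1, hy, TensorProduct.tmul_smul]
  rw [Algebra.algebraMap_eq_smul_one, Algebra.TensorProduct.one_def]

end BialgHom

/-! ### Decompositions into two commuting factors -/

namespace HopfSubalgebra

variable {k H : Type*} [Field k] [Ring H] [HopfAlgebra k H]

/-- `H` is the internal tensor product of its commuting Hopf subalgebras `A` and `B`. -/
structure IsTensorPair (A B : HopfSubalgebra k H) : Prop where
  commute : ∀ a ∈ A.toSubalgebra, ∀ b ∈ B.toSubalgebra, Commute a b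
  inf_eq_bot : A.toSubalgebra ⊓ B.toSubalgebra = ⊥
  sup_eq_top : A.toSubalgebra ⊔ B.toSubalgebra = ⊤

namespace IsTensorPair

variable {A B : HopfSubalgebra k H}

theorem symm (h : IsTensorPair A B) : IsTensorPair B A where
  commute b hb a ha := (h.commute a ha b hb).symm
  inf_eq_bot := by rw [inf_comm, h.inf_eq_bot]
  sup_eq_top := by rw [sup_comm, h.sup_eq_top]

theorem algHom_ext (h : IsTensorPair A B) {X : Type*} [Semiring X] [Algebra k X]
    {f g : H →ₐ[k] X} (hA : ∀ a ∈ A.toSubalgebra, f a = g a)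
    (hB : ∀ b ∈ B.toSubalgebra, f b = g b) : f = g := by
  have hle : A.toSubalgebra ⊔ B.toSubalgebra ≤ AlgHom.equalizer f g := sup_le hA hB
  rw [h.sup_eq_top] at hle
  exact AlgHom.ext fun x => hle (Algebra.mem_top : x ∈ (⊤ : Subalgebra k H))

/-- The multiplication `A ⊗ B → H`. -/
noncomputable def mulHom (h : IsTensorPair A B) : A.toSubalgebra ⊗[k] B.toSubalgebra →ₐc[k] H :=
  BialgHom.tensorLift A.inclBialgHom B.inclBialgHom fun a b => h.commute a a.2 b b.2

@[simp]
theorem mulHom_tmul (h : IsTensorPair A B) (a : A.toSubalgebra) (b : B.toSubalgebra) :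
    h.mulHom (a ⊗ₜ b) = a * b := rfl

theorem mulHom_surjective (h : IsTensorPair A B) : Function.Surjective h.mulHom := by
  have hle : A.toSubalgebra ⊔ B.toSubalgebra ≤ h.mulHom.toAlgHom.range := by
    refine sup_le (fun a ha => ⟨⟨a, ha⟩ ⊗ₜ 1, ?_⟩) fun b hb => ⟨1 ⊗ₜ ⟨b, hb⟩, ?_⟩
    · exact (h.mulHom_tmul _ _).trans (mul_one _)
    · exact (h.mulHom_tmul _ _).trans (one_mul _)
  rw [h.sup_eq_top] at hle
  exact fun x => hle (Algebra.mem_top : x ∈ (⊤ : Subalgebra k H))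

theorem mulHom_coinvariant (h : IsTensorPair A B) (z : A.toSubalgebra ⊗[k] B.toSubalgebra)
    (hz : (h.mulHom : A.toSubalgebra ⊗[k] B.toSubalgebra →ₗ[k] H).rTensor _ (comul z) =
      1 ⊗ₜ[k] z) :
    z ∈ (⊥ : Subalgebra k (A.toSubalgebra ⊗[k] B.toSubalgebra)) := by
  refine BialgHom.tensorLift_coinvariant _ _ _ A.incl_injective B.incl_injective ?_ z hz
  rintro a ⟨b, hb⟩
  rw [← h.inf_eq_bot]
  refine ⟨a.2, ?_⟩
  rw [← hb]
  exact b.2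

variable [IsSemisimpleRing H] [Module.Finite k H]

theorem mulHom_bijective (h : IsTensorPair A B) : Function.Bijective h.mulHom :=
  ⟨BialgHom.injective_of_coinvariants _ h.mulHom_surjective h.mulHom_coinvariant,
    h.mulHom_surjective⟩

theorem exists_proj (h : IsTensorPair A B) : ∃ q : H →ₐ[k] H,
    (∀ a ∈ A.toSubalgebra, q a = algebraMap k H (counit (R := k) a)) ∧
      ∀ b ∈ B.toSubalgebra, q b = b := by
  let e : A.toSubalgebra ⊗[k] B.toSubalgebra ≃ₐ[k] H :=
    AlgEquiv.ofBijective h.mulHom.toAlgHom h.mulHom_bijective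
  have he : ∀ a b, e (a ⊗ₜ b) = (a : H) * b := fun _ _ => rfl
  -- This is `ε ⊗ id` on `A ⊗ B`, transported to `H` along the multiplication isomorphism.
  let q' : A.toSubalgebra ⊗[k] B.toSubalgebra →ₐ[k] H := Algebra.TensorProduct.lift
    ((Algebra.ofId k H).comp (Bialgebra.counitAlgHom k A.toSubalgebra)) B.inclBialgHom.toAlgHom
    fun a b => Algebra.commutes _ _
  refine ⟨q'.comp e.symm.toAlgHom, fun a ha => ?_, fun b hb => ?_⟩
  · have h1 : e.symm a = (⟨a, ha⟩ : A.toSubalgebra) ⊗ₜ 1 := by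
      rw [e.symm_apply_eq, he]
      exact (mul_one a).symm
    change q' (e.symm a) = _
    rw [h1]
    refine (Algebra.TensorProduct.lift_tmul _ _ _ _ _).trans ?_
    rw [map_one, mul_one]
    rfl
  · have h1 : e.symm b = 1 ⊗ₜ (⟨b, hb⟩ : B.toSubalgebra) := by
      rw [e.symm_apply_eq, he]
      exact (one_mul b).symm
    change q' (e.symm b) = _
    rw [h1]
    refine (Algebra.TensorProduct.lift_tmul _ _ _ _ _).trans ?_
    rw [map_one, one_mul]
    rfl

end IsTensorPair

end HopfSubalgebra

/-! ### Adjoint actions, images and intersections -/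

namespace HopfSubalgebra

section Functoriality

variable {k H X : Type*} [Field k] [Ring H] [HopfAlgebra k H] [Ring X] [HopfAlgebra k X]

theorem map_leftAdjoint (f : H →ₐc[k] X) (h a : H) :
    f (leftAdjoint k h a) = leftAdjoint k (f h) (f a) := by
  rw [leftAdjoint_eq_sum (ℛ k h), leftAdjoint_eq_sum ((ℛ k h).induced f)]
  simp [BialgHom.map_antipode]

theorem map_rightAdjoint (f : H →ₐc[k] X) (h a : H) :
    f (rightAdjoint k h a) = rightAdjoint k (f h) (f a) := by
  rw [rightAdjoint_eq_sum (ℛ k h), rightAdjoint_eq_sum ((ℛ k h).induced f)]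
  simp [BialgHom.map_antipode]

theorem leftAdjoint_mul (g h a : H) :
    leftAdjoint k (g * h) a = leftAdjoint k g (leftAdjoint k h a) := by
  rw [leftAdjoint_eq_sum ((ℛ k g).mul (ℛ k h)), leftAdjoint_eq_sum (ℛ k g),
    leftAdjoint_eq_sum (ℛ k h)]
  simp only [Finset.mul_sum, Finset.sum_mul]
  rw [← Finset.sum_product']
  exact Finset.sum_congr rfl fun p _ => by
    simp [Coalgebra.Repr.mul, antipode_mul_antidistrib, mul_assoc]

theorem rightAdjoint_mul (g h a : H) :
    rightAdjoint k (g * h) a = rightAdjoint k h (rightAdjoint k g a) := by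
  rw [rightAdjoint_eq_sum ((ℛ k g).mul (ℛ k h)), rightAdjoint_eq_sum (ℛ k g),
    rightAdjoint_eq_sum (ℛ k h)]
  simp only [Finset.mul_sum, Finset.sum_mul]
  rw [Finset.sum_comm, ← Finset.sum_product']
  exact Finset.sum_congr rfl fun p _ => by
    simp [Coalgebra.Repr.mul, antipode_mul_antidistrib, mul_assoc]

theorem leftAdjoint_of_commute {h a : H} (A : HopfSubalgebra k H) (hh : h ∈ A.toSubalgebra)
    (hc : ∀ x ∈ A.toSubalgebra, Commute x a) :
    leftAdjoint k h a = counit (R := k) h • a := by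
  obtain ⟨r, hr₁, -⟩ := A.exists_repr hh
  have e := sum_mul_antipode_eq_smul r
  rw [leftAdjoint_eq_sum r]
  simp only [(hc _ (hr₁ _)).eq, mul_assoc, ← Finset.mul_sum]
  rw [e, mul_smul_comm, mul_one]

theorem rightAdjoint_of_commute {h a : H} (A : HopfSubalgebra k H) (hh : h ∈ A.toSubalgebra)
    (hc : ∀ x ∈ A.toSubalgebra, Commute x a) :
    rightAdjoint k h a = counit (R := k) h • a := by
  obtain ⟨r, -, hr₂⟩ := A.exists_repr hh
  have e := sum_antipode_mul_eq_smul r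
  rw [rightAdjoint_eq_sum r]
  simp only [← (hc _ (hr₂ _)).eq, ← mul_assoc, ← Finset.sum_mul]
  rw [e, smul_mul_assoc, one_mul]

theorem sum_tmul_mem_range {N : Subalgebra k H} {ι : Type*} (s : Finset ι) (x y : ι → H)
    (hx : ∀ i, x i ∈ N) (hy : ∀ i, y i ∈ N) :
    ∑ i ∈ s, x i ⊗ₜ[k] y i ∈ (Algebra.TensorProduct.map N.val N.val).range :=
  sum_mem fun i _ => ⟨⟨x i, hx i⟩ ⊗ₜ ⟨y i, hy i⟩, rfl⟩

/-- The image of a Hopf subalgebra under a bialgebra homomorphism. -/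
noncomputable def map (f : H →ₐc[k] X) (A : HopfSubalgebra k H) : HopfSubalgebra k X where
  toSubalgebra := A.toSubalgebra.map (f : H →ₐ[k] X)
  comul_mem' := by
    rintro _ ⟨x, hx, rfl⟩
    obtain ⟨r, hr₁, hr₂⟩ := A.exists_repr hx
    have e : ∑ i ∈ r.index, f (r.left i) ⊗ₜ[k] f (r.right i) = comul (R := k) (f x) :=
      (r.induced f).eq
    change comul (R := k) (f x) ∈ _
    rw [← e]
    exact sum_tmul_mem_range _ _ _ (fun i => ⟨_, hr₁ i, rfl⟩) fun i => ⟨_, hr₂ i, rfl⟩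
  antipode_mem' := by
    rintro _ ⟨x, hx, rfl⟩
    exact ⟨_, A.antipode_mem' x hx, f.map_antipode x⟩

theorem mem_map {f : H →ₐc[k] X} {A : HopfSubalgebra k H} {y : X} :
    y ∈ (A.map f).toSubalgebra ↔ ∃ x ∈ A.toSubalgebra, f x = y := Iff.rfl

theorem IsNormal.map {f : H →ₐc[k] X} (hf : Function.Surjective f) {A : HopfSubalgebra k H}
    (hA : A.IsNormal) : (A.map f).IsNormal := by
  rintro h _ ⟨x, hx, rfl⟩
  obtain ⟨h, rfl⟩ := hf h
  exact ⟨⟨_, (hA h x hx).1, map_leftAdjoint f h x⟩, ⟨_, (hA h x hx).2, map_rightAdjoint f h x⟩⟩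

/-- Over a field `(N ⊗ C) ∩ (C ⊗ N) = N ⊗ N`: flatness lifts `z` to `N ⊗ C`, then to `N ⊗ N`. -/
theorem mem_range_map_of_exact {N C Q : Type*} [AddCommGroup N] [Module k N] [AddCommGroup C]
    [Module k C] [AddCommGroup Q] [Module k Q] {ι : N →ₗ[k] C} {w : C →ₗ[k] Q}
    (hι : Function.Injective ι) (hex : Function.Exact ι w) {z : C ⊗[k] C}
    (h₁ : w.rTensor C z = 0) (h₂ : w.lTensor C z = 0) :
    z ∈ LinearMap.range (TensorProduct.map ι ι) := by
  obtain ⟨y, rfl⟩ := (Module.Flat.rTensor_exact C hex z).1 h₁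
  have hy : w.lTensor N y = 0 := by
    apply Module.Flat.rTensor_preserves_injective_linearMap (M := Q) ι hι
    rw [map_zero, ← h₂, ← LinearMap.comp_apply, ← LinearMap.comp_apply,
      LinearMap.lTensor_comp_rTensor, LinearMap.rTensor_comp_lTensor]
  obtain ⟨x, rfl⟩ := (Module.Flat.lTensor_exact N hex y).1 hy
  exact ⟨x, by rw [← LinearMap.comp_apply, LinearMap.rTensor_comp_lTensor]⟩

/-- The intersection of `M` with `A`, as a Hopf subalgebra of `A`. -/
noncomputable def restrict (M A : HopfSubalgebra k H) : HopfSubalgebra k A.toSubalgebra where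
  toSubalgebra := M.toSubalgebra.comap A.toSubalgebra.val
  comul_mem' := by
    intro x hx
    let N : Subalgebra k A.toSubalgebra := M.toSubalgebra.comap A.toSubalgebra.val
    -- The kernel of `w` is the intersection, so it suffices that `w` kills each tensor leg of
    -- `Δ(x)`; this can be tested in `H`, where `Δ(x)` comes from `M ⊗ M`.
    let w : A.toSubalgebra →ₗ[k] H ⧸ Subalgebra.toSubmodule M.toSubalgebra :=
      (Subalgebra.toSubmodule M.toSubalgebra).mkQ ∘ₗ A.incl
    have hex : Function.Exact N.val.toLinearMap w := by
      intro y
      refine (Submodule.Quotient.mk_eq_zero _).trans ⟨fun hy => ⟨⟨y, hy⟩, rfl⟩, ?_⟩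
      rintro ⟨z, rfl⟩
      exact z.2
    obtain ⟨r, hr₁, hr₂⟩ := M.exists_repr (x := x) hx
    have hM : ∀ y ∈ M.toSubalgebra, (Subalgebra.toSubmodule M.toSubalgebra).mkQ y = 0 :=
      fun y hy => (Submodule.Quotient.mk_eq_zero _).2 hy
    have h₁ : w.rTensor A.toSubalgebra (comul (R := k) x) = 0 := by
      apply Module.Flat.lTensor_preserves_injective_linearMap
        (M := H ⧸ Subalgebra.toSubmodule M.toSubalgebra) A.incl A.incl_injective
      have e : A.incl.lTensor _ ∘ₗ w.rTensor A.toSubalgebra =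
          (Subalgebra.toSubmodule M.toSubalgebra).mkQ.rTensor H ∘ₗ
            TensorProduct.map A.incl A.incl := by
        rw [LinearMap.lTensor_comp_rTensor, LinearMap.rTensor_comp_map]
      rw [map_zero, ← LinearMap.comp_apply, e, LinearMap.comp_apply, map_comul, ← r.eq, map_sum]
      exact Finset.sum_eq_zero fun i _ => by
        rw [LinearMap.rTensor_tmul, hM _ (hr₁ i), TensorProduct.zero_tmul]
    have h₂ : w.lTensor A.toSubalgebra (comul (R := k) x) = 0 := by
      apply Module.Flat.rTensor_preserves_injective_linearMap
        (M := H ⧸ Subalgebra.toSubmodule M.toSubalgebra) A.incl A.incl_injective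
      have e : A.incl.rTensor _ ∘ₗ w.lTensor A.toSubalgebra =
          (Subalgebra.toSubmodule M.toSubalgebra).mkQ.lTensor H ∘ₗ
            TensorProduct.map A.incl A.incl := by
        rw [LinearMap.rTensor_comp_lTensor, LinearMap.lTensor_comp_map]
      rw [map_zero, ← LinearMap.comp_apply, e, LinearMap.comp_apply, map_comul, ← r.eq, map_sum]
      exact Finset.sum_eq_zero fun i _ => by
        rw [LinearMap.lTensor_tmul, hM _ (hr₂ i), TensorProduct.tmul_zero]
    exact mem_range_map_of_exact (ι := N.val.toLinearMap) Subtype.val_injective hex h₁ h₂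
  antipode_mem' x hx := M.antipode_mem' _ hx

theorem mem_restrict {M A : HopfSubalgebra k H} {x : A.toSubalgebra} :
    x ∈ (M.restrict A).toSubalgebra ↔ (x : H) ∈ M.toSubalgebra := Iff.rfl

theorem IsNormal.restrict {M : HopfSubalgebra k H} (hM : M.IsNormal) (A : HopfSubalgebra k H) :
    (M.restrict A).IsNormal := fun h a ha => by
  rw [mem_restrict, mem_restrict, ← inclBialgHom_apply, ← inclBialgHom_apply,
    map_leftAdjoint, map_rightAdjoint]
  exact hM h a ha

theorem inf_eq_bot_or_le_of_isSimple {M A : HopfSubalgebra k H} (hM : M.IsNormal)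
    (hA : IsSimpleHopfAlgebra k A.toSubalgebra) :
    A.toSubalgebra ⊓ M.toSubalgebra = ⊥ ∨ A.toSubalgebra ≤ M.toSubalgebra := by
  refine (hA.2 _ (hM.restrict A)).imp (fun h => ?_) fun h => ?_
  · refine eq_bot_iff.2 fun x hx => ?_
    have hx' : (⟨x, hx.1⟩ : A.toSubalgebra) ∈ (M.restrict A).toSubalgebra := hx.2
    rw [h] at hx'
    obtain ⟨c, hc⟩ := Algebra.mem_bot.1 hx'
    exact Algebra.mem_bot.2 ⟨c, congrArg Subtype.val hc⟩
  · intro x hx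
    have hx' : (⟨x, hx⟩ : A.toSubalgebra) ∈ (M.restrict A).toSubalgebra := by
      rw [h]; exact Algebra.mem_top
    exact hx'

end Functoriality

/-! ### Projections onto the factors -/

variable {k H : Type*} [Field k] [Ring H] [HopfAlgebra k H]

namespace IsTensorPair

variable [IsSemisimpleRing H] [Module.Finite k H] {A B : HopfSubalgebra k H}

/-- The projection of `H = A ⊗ B` onto `B`, which is the counit on `A`. -/
noncomputable def proj (h : IsTensorPair A B) : H →ₐ[k] H := h.exists_proj.choose

theorem proj_left (h : IsTensorPair A B) {a : H} (ha : a ∈ A.toSubalgebra) :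
    h.proj a = algebraMap k H (counit (R := k) a) := h.exists_proj.choose_spec.1 a ha

theorem proj_right (h : IsTensorPair A B) {b : H} (hb : b ∈ B.toSubalgebra) :
    h.proj b = b := h.exists_proj.choose_spec.2 b hb

theorem proj_mem (h : IsTensorPair A B) (x : H) : h.proj x ∈ B.toSubalgebra := by
  have hle : A.toSubalgebra ⊔ B.toSubalgebra ≤ B.toSubalgebra.comap h.proj := by
    refine sup_le (fun a ha => ?_) fun b hb => ?_
    · rw [Subalgebra.mem_comap, h.proj_left ha]
      exact Subalgebra.algebraMap_mem _ _
    · rwa [Subalgebra.mem_comap, h.proj_right hb]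
  rw [h.sup_eq_top] at hle
  exact hle (Algebra.mem_top : x ∈ (⊤ : Subalgebra k H))

theorem counit_proj (h : IsTensorPair A B) (x : H) :
    counit (R := k) (h.proj x) = counit (R := k) x := by
  have e : (Bialgebra.counitAlgHom k H).comp h.proj = Bialgebra.counitAlgHom k H := by
    refine h.algHom_ext (fun a ha => ?_) fun b hb => ?_
    · simp [h.proj_left ha]
    · simp [h.proj_right hb]
  exact DFunLike.congr_fun e x

theorem map_comul_proj (h : IsTensorPair A B) (x : H) :
    Algebra.TensorProduct.map h.proj h.proj (comul (R := k) x) = comul (R := k) (h.proj x) := by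
  have e : (Algebra.TensorProduct.map h.proj h.proj).comp (Bialgebra.comulAlgHom k H) =
      (Bialgebra.comulAlgHom k H).comp h.proj := by
    refine h.algHom_ext (fun a ha => ?_) fun b hb => ?_
    · obtain ⟨r, hr₁, hr₂⟩ := A.exists_repr ha
      have e' := congrArg (counit (R := k)) (sum_counit_smul r)
      simp only [map_sum, map_smul, smul_eq_mul] at e'
      simp only [AlgHom.comp_apply, Bialgebra.comulAlgHom_apply, ← r.eq, map_sum,
        Algebra.TensorProduct.map_tmul, h.proj_left (hr₁ _), h.proj_left (hr₂ _), h.proj_left ha,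
        ← e']
      simp [Algebra.algebraMap_eq_smul_one, TensorProduct.smul_tmul', TensorProduct.tmul_smul,
        smul_smul, Algebra.TensorProduct.one_def, mul_comm]
    · obtain ⟨r, hr₁, hr₂⟩ := B.exists_repr hb
      simp only [AlgHom.comp_apply, Bialgebra.comulAlgHom_apply, ← r.eq, map_sum,
        Algebra.TensorProduct.map_tmul, h.proj_right (hr₁ _), h.proj_right (hr₂ _),
        h.proj_right hb]
  exact DFunLike.congr_fun e x

/-- The projection of `H = A ⊗ B` onto `B` as a bialgebra homomorphism. -/
noncomputable def projBialgHom (h : IsTensorPair A B) : H →ₐc[k] B.toSubalgebra :=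
  BialgHom.ofAlgHom (h.proj.codRestrict B.toSubalgebra h.proj_mem)
    (AlgHom.ext h.counit_proj)
    (by
      ext x
      apply B.map_incl_injective
      refine Eq.trans ?_ ((h.map_comul_proj x).trans (B.map_comul ⟨h.proj x, h.proj_mem x⟩).symm)
      simp [← (ℛ k x).eq, incl_apply])

@[simp]
theorem coe_projBialgHom (h : IsTensorPair A B) (x : H) : (h.projBialgHom x : H) = h.proj x := rfl

theorem projBialgHom_surjective (h : IsTensorPair A B) : Function.Surjective h.projBialgHom :=
  fun b => ⟨b, Subtype.ext (h.proj_right b.2)⟩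

/-- With commuting values, `x ↦ p(x₁) q(x₂)` is an algebra map, so it need only be compared with the
identity on `A` and on `B`. -/
theorem sum_proj_mul_proj (h : IsTensorPair A B) {ι : Type*} {x : H} (r : Coalgebra.Repr k x ι) :
    ∑ i ∈ r.index, h.symm.proj (r.left i) * h.proj (r.right i) = x := by
  have e : (Algebra.TensorProduct.lift h.symm.proj h.proj fun x y =>
      h.commute _ (h.symm.proj_mem x) _ (h.proj_mem y)).comp (Bialgebra.comulAlgHom k H) =
      AlgHom.id k H := by
    refine h.algHom_ext (fun a ha => ?_) fun b hb => ?_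
    · obtain ⟨t, ht₁, ht₂⟩ := A.exists_repr ha
      simp only [AlgHom.comp_apply, Bialgebra.comulAlgHom_apply, ← t.eq, map_sum,
        Algebra.TensorProduct.lift_tmul, h.proj_left (ht₂ _), h.symm.proj_right (ht₁ _)]
      conv_rhs => rw [AlgHom.id_apply, ← t.sum_counit_right_smul]
      simp [Algebra.algebraMap_eq_smul_one]
    · obtain ⟨t, ht₁, ht₂⟩ := B.exists_repr hb
      simp only [AlgHom.comp_apply, Bialgebra.comulAlgHom_apply, ← t.eq, map_sum,
        Algebra.TensorProduct.lift_tmul, h.symm.proj_left (ht₁ _), h.proj_right (ht₂ _)]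
      conv_rhs => rw [AlgHom.id_apply, ← sum_counit_smul t]
      simp [Algebra.algebraMap_eq_smul_one]
  have e' := DFunLike.congr_fun e x
  simpa only [AlgHom.comp_apply, Bialgebra.comulAlgHom_apply, ← r.eq, map_sum,
    Algebra.TensorProduct.lift_tmul, AlgHom.id_apply] using e'

/-- Every `x` is a sum of products of elements of `A` and `B`. The adjoint action of `B` preserves
`B`, and that of `A` on `B` is through the counit because the factors commute. -/
theorem isNormal_right (h : IsTensorPair A B) : B.IsNormal := by
  intro x b hb
  have hl : ∀ a ∈ A.toSubalgebra, ∀ y, ∀ b ∈ B.toSubalgebra,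
      leftAdjoint k (a * h.proj y) b ∈ B.toSubalgebra := by
    intro a ha y b hb
    have hyb : leftAdjoint k (h.proj y) b ∈ B.toSubalgebra := by
      obtain ⟨r, hr₁, hr₂⟩ := B.exists_repr (h.proj_mem y)
      rw [leftAdjoint_eq_sum r]
      exact sum_mem fun i _ => mul_mem (mul_mem (hr₁ i) hb) (B.antipode_mem' _ (hr₂ i))
    rw [leftAdjoint_mul, leftAdjoint_of_commute A ha fun x hx => h.commute x hx _ hyb]
    exact Subalgebra.smul_mem _ hyb _
  have hr : ∀ a ∈ A.toSubalgebra, ∀ y, ∀ b ∈ B.toSubalgebra,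
      rightAdjoint k (a * h.proj y) b ∈ B.toSubalgebra := by
    intro a ha y b hb
    rw [rightAdjoint_mul, rightAdjoint_of_commute A ha fun x hx => h.commute x hx _ hb]
    obtain ⟨r, hr₁, hr₂⟩ := B.exists_repr (h.proj_mem y)
    rw [rightAdjoint_eq_sum r]
    exact sum_mem fun i _ => mul_mem (B.antipode_mem' _ (hr₁ i))
      (mul_mem (Subalgebra.smul_mem _ hb _) (hr₂ i))
  rw [← h.sum_proj_mul_proj (ℛ k x)]
  constructor
  · simp only [leftAdjoint, map_sum]
    exact sum_mem fun i _ => hl _ (h.symm.proj_mem _) _ b hb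
  · simp only [rightAdjoint, map_sum]
    exact sum_mem fun i _ => hr _ (h.symm.proj_mem _) _ b hb

end IsTensorPair

end HopfSubalgebra

/-! ### Internal tensor products of families -/

namespace HopfSubalgebra

variable {k H : Type*} [Field k] [Ring H] [HopfAlgebra k H]

theorem le_generate {ι : Type*} (K : ι → HopfSubalgebra k H) (i : ι) :
    (K i).toSubalgebra ≤ (generate K).toSubalgebra :=
  le_iSup (fun i => (K i).toSubalgebra) i

namespace IsInternalTensorProduct

variable {ι : Type*} {L : ι → HopfSubalgebra k H}

theorem isTensorPair (hL : IsInternalTensorProduct L) (i : ι) :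
    IsTensorPair (L i) (generate fun j : {j : ι // j ≠ i} => L j) where
  commute a ha b hb := by
    have hle : (generate fun j : {j : ι // j ≠ i} => L j).toSubalgebra ≤
        Subalgebra.centralizer k {a} := by
      refine iSup_le fun j b hb => ?_
      rw [Subalgebra.mem_centralizer_iff]
      rintro _ rfl
      refine commute_of_isNormal (hL.normal i) (hL.normal j) (eq_bot_iff.2 ?_) ha hb
      rw [← hL.inf_eq_bot i]
      exact inf_le_inf_left _ (le_generate (fun j : {j : ι // j ≠ i} => L j) j)
    exact (Subalgebra.mem_centralizer_iff k).1 (hle hb) a rfl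
  inf_eq_bot := hL.inf_eq_bot i
  sup_eq_top := by
    classical
    rw [eq_top_iff, ← hL.generate_eq_top]
    refine iSup_le fun j => ?_
    by_cases hj : j = i
    · subst hj
      exact le_sup_left
    · exact le_sup_of_le_right (le_generate (fun j : {j : ι // j ≠ i} => L j) ⟨j, hj⟩)

variable [IsSemisimpleRing H] [Module.Finite k H]

/-- An element of all complements `⟨L j | j ≠ i⟩`, `i ∈ U`, is generated by the `L j`, `j ∉ U`. -/
theorem mem_iSup_of_forall_mem (hL : IsInternalTensorProduct L) (U : Finset ι) (x : H)
    (hx : ∀ i ∈ U, x ∈ (generate fun j : {j : ι // j ≠ i} => L j).toSubalgebra) :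
    x ∈ ⨆ j : {j : ι // j ∉ U}, (L j).toSubalgebra := by
  classical
  induction U using Finset.induction_on with
  | empty =>
    have hle : (generate L).toSubalgebra ≤
        ⨆ j : {j : ι // j ∉ (∅ : Finset ι)}, (L j).toSubalgebra :=
      iSup_le fun j => le_iSup (fun j : {j : ι // j ∉ (∅ : Finset ι)} => (L j).toSubalgebra)
        ⟨j, Finset.notMem_empty j⟩
    rw [hL.generate_eq_top] at hle
    exact hle Algebra.mem_top
  | insert i U _ ih =>
    have h := hL.isTensorPair i
    -- The projection that collapses `L i` to scalars fixes `x` and every `L j` with `j ≠ i`, so it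
    -- removes `L i` from the generators needed for `x`.
    rw [← h.proj_right (hx i (Finset.mem_insert_self i U))]
    have hle : (⨆ j : {j : ι // j ∉ U}, (L j).toSubalgebra) ≤
        (⨆ j : {j : ι // j ∉ insert i U}, (L j).toSubalgebra).comap h.proj := by
      refine iSup_le fun j y hy => ?_
      rw [Subalgebra.mem_comap]
      by_cases hj : (j : ι) = i
      · rw [hj] at hy
        rw [h.proj_left hy]
        exact Subalgebra.algebraMap_mem _ _
      · rw [h.proj_right (le_generate (fun j : {j : ι // j ≠ i} => L j) ⟨j, hj⟩ hy)]
        exact le_iSup (fun j : {j : ι // j ∉ insert i U} => (L j).toSubalgebra)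
          ⟨j, by simp [hj, j.2]⟩ hy
    exact hle (ih fun j hj => hx j (Finset.mem_insert_of_mem hj))

end IsInternalTensorProduct

/-! ### The exchange lemma -/

section Exchange

variable [IsSemisimpleRing H] [Module.Finite k H] {A M K : HopfSubalgebra k H}

/-- If `p(K)` is trivial, then `p = ε` on `K`, so in `x = p(x₁) q(x₂)` only factors from `M` and
scalars remain. -/
theorem IsTensorPair.le_right_of_map_eq_bot (h : IsTensorPair A M)
    (hK : (K.map h.symm.projBialgHom).toSubalgebra = ⊥) : K.toSubalgebra ≤ M.toSubalgebra := by
  have hp : ∀ x ∈ K.toSubalgebra, h.symm.proj x = algebraMap k H (counit (R := k) x) := by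
    intro x hx
    have hx' : h.symm.projBialgHom x ∈ (K.map h.symm.projBialgHom).toSubalgebra := ⟨x, hx, rfl⟩
    rw [hK] at hx'
    obtain ⟨c, hc⟩ := Algebra.mem_bot.1 hx'
    have hc' : algebraMap k H c = h.symm.proj x := congrArg Subtype.val hc
    rw [← hc', ← h.symm.counit_proj, ← hc', Bialgebra.counit_algebraMap]
  intro x hx
  obtain ⟨r, hr₁, -⟩ := K.exists_repr hx
  rw [← h.sum_proj_mul_proj r]
  refine sum_mem fun i _ => ?_
  rw [hp _ (hr₁ i)]
  exact mul_mem (Subalgebra.algebraMap_mem _ _) (h.proj_mem _)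

theorem IsTensorPair.injective_projBialgHom_comp (h : IsTensorPair A M)
    [IsSemisimpleRing A.toSubalgebra] (hinf : K.toSubalgebra ⊓ M.toSubalgebra = ⊥)
    (hsurj : Function.Surjective (h.symm.projBialgHom.comp K.inclBialgHom)) :
    Function.Injective (h.symm.projBialgHom.comp K.inclBialgHom) := by
  have : Module.Finite k A.toSubalgebra :=
    Module.Finite.of_injective A.incl A.incl_injective
  refine BialgHom.injective_of_coinvariants _ hsurj fun x hx => ?_
  -- Applying `a ⊗ y ↦ a q(y)` to the coinvariance `p(x₁) ⊗ x₂ = 1 ⊗ x` gives `x = q(x)`, which puts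
  -- `x` in `K ∩ M`.
  let m : A.toSubalgebra ⊗[k] K.toSubalgebra →ₗ[k] H :=
    LinearMap.mul' k H ∘ₗ TensorProduct.map A.incl (h.proj.toLinearMap ∘ₗ K.incl)
  have e := congrArg m hx
  have e₁ : m (((h.symm.projBialgHom.comp K.inclBialgHom :
      K.toSubalgebra →ₐc[k] A.toSubalgebra) : K.toSubalgebra →ₗ[k] A.toSubalgebra).rTensor
        K.toSubalgebra (comul x)) = x := by
    conv_rhs => rw [← inclBialgHom_apply, ← h.sum_proj_mul_proj ((ℛ k x).induced K.inclBialgHom)]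
    simp [m, ← (ℛ k x).eq, incl_apply]
  have e₂ : m (1 ⊗ₜ[k] x) = h.proj x := by simp [m, incl_apply]
  rw [e₁, e₂] at e
  have hmem : (x : H) ∈ K.toSubalgebra ⊓ M.toSubalgebra := ⟨x.2, by rw [e]; exact h.proj_mem _⟩
  rw [hinf] at hmem
  obtain ⟨c, hc⟩ := Algebra.mem_bot.1 hmem
  exact Algebra.mem_bot.2 ⟨c, Subtype.ext hc⟩

/-- Solving `id = p * q` for `p` gives `p(x) = x₁ S(q(x₂))`. For `x` in `K` this is a sum of
products from `K` and `M`, and by surjectivity these values exhaust `A`. -/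
theorem IsTensorPair.le_sup_of_surjective (h : IsTensorPair A M)
    (hsurj : Function.Surjective (h.symm.projBialgHom.comp K.inclBialgHom)) :
    A.toSubalgebra ≤ K.toSubalgebra ⊔ M.toSubalgebra := by
  let q : H →ₗ[k] H := M.incl ∘ₗ (h.projBialgHom : H →ₗ[k] M.toSubalgebra)
  have hq : toConv q * toConv (antipode k ∘ₗ q) = 1 :=
    BialgHom.mul_antipode_comp (M.inclBialgHom.comp h.projBialgHom)
  have hpq : toConv h.symm.proj.toLinearMap * toConv q = toConv LinearMap.id := by
    ext x
    rw [(ℛ k x).convMul_apply]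
    exact h.sum_proj_mul_proj (ℛ k x)
  have hp : toConv h.symm.proj.toLinearMap = toConv LinearMap.id * toConv (antipode k ∘ₗ q) := by
    rw [← hpq, mul_assoc, hq, mul_one]
  intro a ha
  obtain ⟨x, hx⟩ := hsurj ⟨a, ha⟩
  have hx' : h.symm.proj x = a := congrArg Subtype.val hx
  have e := congrArg (fun F : WithConv (H →ₗ[k] H) => F x) hp
  obtain ⟨r, hr₁, -⟩ := K.exists_repr x.2
  simp only [r.convMul_apply] at e
  change h.symm.proj x = ∑ i ∈ r.index, r.left i * antipode k (h.proj (r.right i)) at e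
  rw [← hx', e]
  exact sum_mem fun i _ => mul_mem (le_sup_left (a := K.toSubalgebra) (hr₁ i))
    (le_sup_right (a := K.toSubalgebra) (M.antipode_mem' _ (h.proj_mem _)))

/-- If `H = A ⊗ M` with `A` simple, then any simple normal Hopf subalgebra `K` not contained in
`M` is isomorphic to `A` and `H = K ⊗ M`. -/
theorem IsTensorPair.exchange (h : IsTensorPair A M) [IsSemisimpleRing A.toSubalgebra]
    (hA : IsSimpleHopfAlgebra k A.toSubalgebra) (hK : IsSimpleHopfAlgebra k K.toSubalgebra)
    (hKn : K.IsNormal) (hKM : ¬ K.toSubalgebra ≤ M.toSubalgebra) :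
    Nonempty (K.toSubalgebra ≃ₐc[k] A.toSubalgebra) ∧ IsTensorPair K M := by
  have hinf : K.toSubalgebra ⊓ M.toSubalgebra = ⊥ :=
    (inf_eq_bot_or_le_of_isSimple h.isNormal_right hK).resolve_right hKM
  have htop := (hA.2 _ (hKn.map h.symm.projBialgHom_surjective)).resolve_left
    fun hbot => hKM (h.le_right_of_map_eq_bot hbot)
  have hsurj : Function.Surjective (h.symm.projBialgHom.comp K.inclBialgHom) := by
    intro a
    have ha : a ∈ (K.map h.symm.projBialgHom).toSubalgebra := by
      rw [htop]; exact Algebra.mem_top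
    obtain ⟨x, hx, rfl⟩ := mem_map.1 ha
    exact ⟨⟨x, hx⟩, rfl⟩
  refine ⟨⟨BialgEquiv.ofBijective _ ⟨h.injective_projBialgHom_comp hinf hsurj, hsurj⟩⟩, ?_, hinf, ?_⟩
  · exact fun a ha b hb => commute_of_isNormal hKn h.isNormal_right hinf ha hb
  · rw [eq_top_iff, ← h.sup_eq_top]
    exact sup_le (h.le_sup_of_surjective hsurj) le_sup_right

theorem IsInternalTensorProduct.update {ι : Type*} [DecidableEq ι] {L : ι → HopfSubalgebra k H}
    (hL : IsInternalTensorProduct L) (j : ι) (hKn : K.IsNormal)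
    (hK : IsTensorPair K (generate fun l : {l : ι // l ≠ j} => L l)) :
    IsInternalTensorProduct (Function.update L j K) := by
  have hne : ∀ {l}, l ≠ j → Function.update L j K l = L l :=
    fun h => Function.update_of_ne h _ _
  refine ⟨fun i => ?_, ?_, fun i => ?_⟩
  · by_cases hi : i = j
    · subst hi
      rwa [Function.update_self]
    · rw [hne hi]
      exact hL.normal i
  · rw [eq_top_iff, ← hK.sup_eq_top]
    refine sup_le ?_ (iSup_le fun l => ?_)
    · have := le_generate (Function.update L j K) j
      rwa [Function.update_self] at this
    · have := le_generate (Function.update L j K) l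
      rwa [hne l.2] at this
  · by_cases hi : i = j
    · subst hi
      rw [Function.update_self, eq_bot_iff, ← hK.inf_eq_bot]
      refine inf_le_inf_left _ (iSup_le fun l => ?_)
      beta_reduce
      rw [hne l.2]
      exact le_generate (fun l : {l : ι // l ≠ i} => L l) l
    · rw [hne hi, eq_bot_iff, ← hL.inf_eq_bot i]
      rintro x ⟨hx, hx'⟩
      refine ⟨hx, ?_⟩
      -- Projecting along `K` fixes `x` and turns any contribution of `K` into scalars, so `x` is
      -- generated by original factors `L l` with `l ≠ i`.
      have hle : (generate fun l : {l : ι // l ≠ i} => Function.update L j K l).toSubalgebra ≤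
          (generate fun l : {l : ι // l ≠ i} => L l).toSubalgebra.comap hK.proj := by
        refine iSup_le fun l y hy => ?_
        rw [Subalgebra.mem_comap]
        beta_reduce at hy
        by_cases hl : (l : ι) = j
        · rw [hl, Function.update_self] at hy
          rw [hK.proj_left hy]
          exact Subalgebra.algebraMap_mem _ _
        · rw [hne hl] at hy
          rw [hK.proj_right (le_generate (fun l : {l : ι // l ≠ j} => L l) ⟨l, hl⟩ hy)]
          exact le_generate (fun l : {l : ι // l ≠ i} => L l) l hy
      have := hle hx'
      rwa [Subalgebra.mem_comap,
        hK.proj_right (le_generate (fun l : {l : ι // l ≠ j} => L l) ⟨i, hi⟩ hx)] at this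

end Exchange

end HopfSubalgebra

/-! ### Exchanging whole decompositions -/

section KrullSchmidtRemak

open HopfSubalgebra

variable {k H : Type*} [Field k] [Ring H] [HopfAlgebra k H]

theorem IsSimpleHopfAlgebra.toSubalgebra_ne_bot {K : HopfSubalgebra k H}
    (hK : IsSimpleHopfAlgebra k K.toSubalgebra) : K.toSubalgebra ≠ ⊥ := by
  intro h
  refine hK.1 (eq_bot_iff.2 fun x _ => ?_)
  have hx : (x : H) ∈ (⊥ : Subalgebra k H) := h.le x.2
  obtain ⟨c, hc⟩ := Algebra.mem_bot.1 hx
  exact Algebra.mem_bot.2 ⟨c, Subtype.ext hc⟩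

namespace IsKrullSchmidtRemakDecomposition

variable [IsSemisimpleRing H] [Module.Finite k H] {ι κ : Type*} [Fintype κ]
  {K : ι → HopfSubalgebra k H} {L : κ → HopfSubalgebra k H}

/-- Any finitely many factors of one decomposition can be exchanged for pairwise distinct
isomorphic factors of another. -/
theorem exists_exchange (hK : IsKrullSchmidtRemakDecomposition K)
    (hL : IsKrullSchmidtRemakDecomposition L) (I : Finset ι) :
    ∃ (L' : κ → HopfSubalgebra k H) (σ : ι → κ), IsInternalTensorProduct L' ∧
      Set.InjOn σ I ∧ (∀ i ∈ I, L' (σ i) = K i) ∧ (∀ j, (∀ i ∈ I, σ i ≠ j) → L' j = L j) ∧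
      ∀ i ∈ I, Nonempty ((K i).toSubalgebra ≃ₐc[k] (L (σ i)).toSubalgebra) := by
  classical
  induction I using Finset.induction_on with
  | empty =>
    -- A function `ι → κ` must exist even before any exchange. If `κ` is empty then `H = k` has no
    -- simple factor, so `ι` is empty too.
    rcases isEmpty_or_nonempty κ with hκ | ⟨⟨j⟩⟩
    · have hι : IsEmpty ι := ⟨fun i => by
        refine (hK.simple i).toSubalgebra_ne_bot (eq_bot_iff.2 ?_)
        have h := hL.internal.generate_eq_top
        have hle : (generate L).toSubalgebra ≤ ⊥ := iSup_le fun j => hκ.elim j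
        rw [h] at hle
        exact le_top.trans hle⟩
      exact ⟨L, hι.elim, hL.internal, by simp, by simp, fun _ _ => rfl, by simp⟩
    · exact ⟨L, fun _ => j, hL.internal, by simp, by simp, fun _ _ => rfl, by simp⟩
  | insert i I hi ih =>
    obtain ⟨L', σ, hL', hσ, hσK, hσL, hiso⟩ := ih
    -- Otherwise `K i` lies in the complement of every unused `L' j`, hence in what the used ones
    -- generate. Those are the `K i'` with `i' ∈ I`, which meet `K i` only in scalars.
    obtain ⟨j, hj, hij⟩ : ∃ j, (∀ i' ∈ I, σ i' ≠ j) ∧ ¬ (K i).toSubalgebra ≤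
        (generate fun l : {l : κ // l ≠ j} => L' l).toSubalgebra := by
      by_contra! hcon
      refine (hK.simple i).toSubalgebra_ne_bot (eq_bot_iff.2 ?_)
      rw [← hK.internal.inf_eq_bot i]
      refine le_inf le_rfl fun x hx => ?_
      have hmem := hL'.mem_iSup_of_forall_mem (Finset.univ.filter fun j => ∀ i' ∈ I, σ i' ≠ j) x
        fun j hj => hcon j (Finset.mem_filter.1 hj).2 hx
      refine (iSup_le fun l => ?_ : _ ≤ (generate fun j : {j : ι // j ≠ i} => K j).toSubalgebra)
        hmem
      have hl := l.2
      simp only [Finset.mem_filter, Finset.mem_univ, true_and, not_forall, not_not] at hl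
      obtain ⟨i', hi', hl⟩ := hl
      rw [← hl, hσK i' hi']
      exact le_generate (fun j : {j : ι // j ≠ i} => K j) ⟨i', fun h => hi (h ▸ hi')⟩
    -- An unused factor is still the original `L j`, hence simple and semisimple, and the
    -- isomorphism obtained is with `L j` itself.
    have hLj : L' j = L j := hσL j hj
    have hpair := hL'.isTensorPair j
    have hss : IsSemisimpleRing (L' j).toSubalgebra := by
      rw [hLj]
      exact hL.semisimple j
    obtain ⟨he, hpair'⟩ := hpair.exchange (by rw [hLj]; exact hL.simple j) (hK.simple i)
      (hK.internal.normal i) hij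
    have hσi : ∀ i' ∈ I, Function.update σ i j i' = σ i' := fun i' hi' =>
      Function.update_of_ne (ne_of_mem_of_not_mem hi' hi) _ _
    refine ⟨Function.update L' j (K i), Function.update σ i j,
      hL'.update j (hK.internal.normal i) hpair', ?_, ?_, ?_, ?_⟩
    · intro a ha b hb hab
      rcases Finset.mem_insert.1 ha with ha | ha <;>
        rcases Finset.mem_insert.1 hb with hb | hb
      · rw [ha, hb]
      · rw [ha, Function.update_self, hσi b hb] at hab
        exact absurd hab.symm (hj b hb)
      · rw [hb, Function.update_self, hσi a ha] at hab
        exact absurd hab (hj a ha)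
      · rw [hσi a ha, hσi b hb] at hab
        exact hσ ha hb hab
    · intro i' hi'
      rcases Finset.mem_insert.1 hi' with rfl | hi'
      · rw [Function.update_self, Function.update_self]
      · rw [hσi i' hi', Function.update_of_ne (hj i' hi'), hσK i' hi']
    · intro l hl
      have hlj : l ≠ j := by
        have := hl i (Finset.mem_insert_self i I)
        rw [Function.update_self] at this
        exact this.symm
      rw [Function.update_of_ne hlj]
      refine hσL l fun i' hi' => ?_
      rw [← hσi i' hi']
      exact hl i' (Finset.mem_insert_of_mem hi')
    · intro i' hi'
      rcases Finset.mem_insert.1 hi' with rfl | hi'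
      · rw [Function.update_self]
        rwa [hLj] at he
      · rw [hσi i' hi']
        exact hiso i' hi'

theorem exists_injective [Fintype ι] (hK : IsKrullSchmidtRemakDecomposition K)
    (hL : IsKrullSchmidtRemakDecomposition L) :
    ∃ σ : ι → κ, Function.Injective σ ∧
      ∀ i, Nonempty ((K i).toSubalgebra ≃ₐc[k] (L (σ i)).toSubalgebra) := by
  obtain ⟨-, σ, -, hσ, -, -, hiso⟩ := exists_exchange hK hL Finset.univ
  exact ⟨σ, by simpa using hσ, fun i => hiso i (Finset.mem_univ i)⟩

end IsKrullSchmidtRemakDecomposition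

end KrullSchmidtRemak

theorem corollary4p6 {k H : Type*} [Field k] [IsAlgClosed k] [CharZero k]
    [Ring H] [HopfAlgebra k H] [Module.Finite k H] [IsSemisimpleRing H]
    {r s : ℕ} (K : Fin r → HopfSubalgebra k H) (L : Fin s → HopfSubalgebra k H)
    (hK : IsKrullSchmidtRemakDecomposition K) (hL : IsKrullSchmidtRemakDecomposition L) :
    ∃ h : r = s, ∃ σ : Equiv.Perm (Fin r), ∀ i : Fin r,
      Nonempty ((K i).toSubalgebra ≃ₐc[k] (L (Fin.cast h (σ i))).toSubalgebra) := by
  obtain ⟨σ, hσ, hiso⟩ := hK.exists_injective hL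
  obtain ⟨τ, hτ, -⟩ := hL.exists_injective hK
  have hrs : r = s := le_antisymm (by simpa using Fintype.card_le_of_injective σ hσ)
    (by simpa using Fintype.card_le_of_injective τ hτ)
  subst hrs
  exact ⟨rfl, Equiv.ofBijective σ (Finite.injective_iff_bijective.1 hσ), hiso⟩
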